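/- **Theorem (Abstraction: specification by an interface set).** *States.* Let $\Sigma$ be a separation algebra: a set with a partial commutative, associative and cancellative operation $*$ and a unit $e$. The footprint of a state is $\delta(\sigma)=\{\sigma' \mid \forall \sigma''.\ (\sigma'*\sigma'')\text{ is defined} \iff (\sigma*\sigma'')\text{ is defined}\}$. On footprints, $\delta(\sigma_1)\circ\delta(\sigma_2)=\delta(\sigma_1*\sigma_2)$ when $\sigma_1*\sigma_2$ is defined, and $l_2\setminus l_1=l$ when $l_1=\delta(\sigma_1)$, $l_2=\delta(\sigma_1*\sigma)$ and $l=\delta(\sigma)$ for some $\sigma_1,\sigma$; write $l_1\preceq l_2$ when $l_2\setminus l_1$ is defined. Assume $*$ is cancellative on footprints: if $\sigma_1*\sigma_2$, $\sigma_1'*\sigma_2'$ are defined, $\delta(\sigma_1*\sigma_2)=\delta(\sigma_1'*\sigma_2')$ and $\delta(\sigma_1)=\delta(\sigma_1')$, then $\delta(\sigma_2)=\delta(\sigma_2')$. *Histories.* Interface actions are $(t,\mathsf{call}\ m(\sigma))$ and $(t,\mathsf{ret}\ m(\sigma))$ for a thread $t$, a method $m$ and a state $\sigma$. A history is a finite sequence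 of interface actions in which every thread alternates calls and matching returns, starting from a call. It is balanced from a footprint $l$ if, starting from $l$ and reading it from left to right, adding ($\circ$) $\delta(\sigma)$ at every call and subtracting ($\setminus$) it at every return is always defined. An interface set is a set of pairs $(l,H)$ with $H$ a history balanced from the footprint $l$. For interface sets, $\mathcal H_1\sqsubseteq\mathcal H_2$ means: for every $(l_1,H_1)\in\mathcal H_1$ there is $(l_2,H_2)\in\mathcal H_2$ with $l_2\preceq l_1$ and a bijection $\rho$ from the positions of $H_1$ to those of $H_2$ such that $H_1(i)=H_2(\rho(i))$ for all $i$, and $\rho(i)<\rho(j)$ whenever $i<j$ and either $H_1(i)$, $H_1(j)$ are by the same thread or $H_1(i)$ is a return and $H_1(j)$ is a call. *Programs.* Commands are built from primitive commands $c$ and method calls $m$ by sequencing, choice and finite iteration. A library $\mathcal L$ gives bodies without method calls to finitely many methods; a client $\mathcal C$ is a parallel composition of commands $C_1\parallel\dots\parallel C_n$ run by threads $1,\dots,n$; $\mathcal C(\mathcal L)$ is the complete program. Each $c$ and thread $t$ have a transformer $f^t_c:\Sigma\to\mathcal P(\Sigma)\cup\{\top\}$ ($\top$ is a fault) such that $\sigma'\in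 f^t_c(\sigma)$ implies $\delta(\sigma')=\delta(\sigma)$, and if $\sigma_1*\sigma_2$ is defined and $f_c^t(\sigma_1)\neq\top$ then $f^t_c(\sigma_1*\sigma_2)=f^t_c(\sigma_1)*\{\sigma_2\}$. A specification $\Gamma$ assigns to each of some methods $m$ a precondition $p_t$ and a postcondition $q_t$ ($t$ a thread), all precise: every state has at most one substate in the predicate. $\mathcal L:\Gamma$ means that $\Gamma$ specifies exactly the methods of $\mathcal L$, and $\Gamma\vdash\mathcal C$ that it specifies all methods that $\mathcal C$ may call. *Semantics.* Programs denote sets of finite traces. Action sequences are generated from the syntax (prefixes of interleavings of thread executions, where a call of $m$ yields $(t,\mathsf{call}\ m)$, an execution of the body, $(t,\mathsf{ret}\ m)$) and then evaluated from an initial state, primitive commands by $f^t_c$; the program has no denotation ($\top$) at states from which one of its sequences can fault. In $\mathcal C(\mathcal L)$ calls and returns leave the state unchanged and are not annotated. In the client-local semantics of $\Gamma\vdash\mathcal C$ method bodies are empty; a call gives up the substate satisfying $p_t$ (faulting if there is none), a return adds an arbitrary compatible state satisfying $q_t$, and both actions are annotated with the state transferred. In the library-local semantics of $\mathcal L:\Gamma$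 the library is run by arbitrarily many threads, each repeatedly calling arbitrary methods; a call adds an arbitrary compatible state satisfying $p_t$, a return gives up the substate satisfying $q_t$ (faulting if there is none), again with annotations. A program is safe for a set of initial states if its denotation is not $\top$ at any of them; $[\![P,J]\!]$ is the set of pairs $(\sigma,\tau)$ with $\sigma\in J$ and $\tau$ a trace of $P$ from $\sigma$. For a trace $\tau$: $\mathsf{history}(\tau)$ is its projection to calls and returns; $\mathsf{client}(\tau)$ is its projection to calls, returns and the primitive actions performed by threads not inside a method; $\mathsf{ground}(\tau)$ erases the state annotations; and $\kappa\sim\kappa'$ means that $\kappa$ and $\kappa'$ have the same projection to each thread and the same projection to primitive actions (those other than calls and returns). *Claim.* Let $I,I_1\subseteq\Sigma$, let $\mathcal H_2$ be an interface set, and suppose that $\mathcal L_1:\Gamma$ and $\Gamma\vdash\mathcal C$ are safe for $I_1$ and $I$, respectively, and that $(\mathcal L_1:\Gamma,I_1)$ is linearized by $\mathcal H_2$, that is, $$\{(\delta(\sigma_0),\mathsf{history}(\tau))\mid(\sigma_0,\tau)\in[\![\mathcal L_1:\Gamma,\,I_1]\!]\}\sqsubseteq\mathcal H_2 .$$ Then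 $\mathcal C(\mathcal L_1)$ is safe for $I*I_1=\{\sigma*\sigma_1\mid\sigma\in I,\ \sigma_1\in I_1,\ \sigma*\sigma_1\text{ defined}\}$, and for every $(\sigma,\tau_1)\in[\![\mathcal C(\mathcal L_1),\,I*I_1]\!]$ there exist $\sigma'$, $\kappa$ and $l$ such that $$(\sigma',\kappa)\in[\![\Gamma\vdash\mathcal C,\,I]\!],\qquad (l,\mathsf{history}(\kappa))\in\mathcal H_2,\qquad \delta(\sigma')\circ l\ \text{is defined},\qquad \mathsf{client}(\tau_1)\sim\mathsf{ground}(\kappa).$$ -/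

import Mathlib

/-! ## Separation algebras and footprints -/

/-- A separation algebra: a partial commutative, associative, cancellative operation `op` with a
unit `e`; `op a b = none` means that `a * b` is undefined. -/
class SepAlgebra (St : Type*) where
  op : St → St → Option St
  e : St
  op_comm : ∀ a b, op a b = op b a
  op_assoc : ∀ a b c, (op a b).bind (fun x => op x c) = (op b c).bind (fun x => op a x)
  e_op : ∀ a, op e a = some a
  op_cancel : ∀ a b c x, op a b = some x → op a c = some x → b = c

namespace OwnershipLin

open SepAlgebra

section Footprints

variable {St : Type*} [SepAlgebra St]

/-- `a` and `b` are compatible: `a * b` is defined. -/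
def Compat (a b : St) : Prop := ∃ x, op a b = some x

/-- Pointwise lifting of `*` to sets of states. -/
def sepSet (p q : Set St) : Set St :=
  {x | ∃ a ∈ p, ∃ b ∈ q, op a b = some x}

/-- The footprint `δ(σ)` of a state. -/
def footprint (σ : St) : Set St := {σ' | ∀ σ'', Compat σ' σ'' ↔ Compat σ σ''}

/-- `l` belongs to the set of footprints of the algebra. -/
def IsFootprint (l : Set St) : Prop := ∃ σ, footprint σ = l

/-- The graph of the partial operation `l₁ ∘ l₂` on footprints. -/
def FpAdd (l₁ l₂ l : Set St) : Prop :=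
  ∃ σ₁ σ₂ σ, l₁ = footprint σ₁ ∧ l₂ = footprint σ₂ ∧ op σ₁ σ₂ = some σ ∧ l = footprint σ

/-- The graph of footprint subtraction: `FpSub l₂ l₁ l` says that `l₂ \\ l₁` is defined and
equal to `l`. -/
def FpSub (l₂ l₁ l : Set St) : Prop :=
  ∃ σ₁ σ₂ σ, l₁ = footprint σ₁ ∧ l₂ = footprint σ₂ ∧ op σ₁ σ = some σ₂ ∧ l = footprint σ

/-- `l₁ ∘ l₂` is defined. -/
def FpCompat (l₁ l₂ : Set St) : Prop := ∃ l, FpAdd l₁ l₂ l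

/-- `l₁ ≼ l₂`: the footprint `l₁` is smaller than `l₂`. -/
def FpLe (l₁ l₂ : Set St) : Prop := ∃ l, FpSub l₂ l₁ l

variable (St) in
/-- The operation `*` is cancellative on footprints. -/
def FootprintCancellative : Prop :=
  ∀ σ₁ σ₂ σ₁' σ₂' σ σ' : St, op σ₁ σ₂ = some σ → op σ₁' σ₂' = some σ' →
    footprint σ = footprint σ' → footprint σ₁ = footprint σ₁' → footprint σ₂ = footprint σ₂'

/-- A predicate is precise if every state has at most one substate satisfying it. -/
def Precise (r : Set St) : Prop :=
  ∀ σ σ₁ σ₁' σ₂ σ₂', σ₁ ∈ r → σ₁' ∈ r → op σ₁ σ₂ = some σ → op σ₁' σ₂' = some σ → σ₁ = σ₁'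

end Footprints

/-! ## Actions, histories, interface sets, linearization -/

/-- Thread identifiers; the threads of a parallel composition of `n` commands are `1, …, n`. -/
abbrev ThreadID := ℕ

/-- Actions.  `call t m (some σ)` and `ret t m (some σ)` are the interface actions
`(t, call m(σ))` and `(t, ret m(σ))`; with `none` they are the unannotated actions
`(t, call m)` and `(t, ret m)`. -/
inductive Act (St Method PComm : Type*) where
  | prim (t : ThreadID) (c : PComm)
  | call (t : ThreadID) (m : Method) (a : Option St)
  | ret (t : ThreadID) (m : Method) (a : Option St)

section Traces

variable {St Method PComm : Type*}

namespace Act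

/-- The thread performing an action. -/
def thread : Act St Method PComm → ThreadID
  | prim t _ => t
  | call t _ _ => t
  | ret t _ _ => t

/-- The action is a call, annotated or not. -/
def isCall : Act St Method PComm → Bool
  | call _ _ _ => true
  | _ => false

/-- The action is a return, annotated or not. -/
def isRet : Act St Method PComm → Bool
  | ret _ _ _ => true
  | _ => false

/-- The action is a call or a return, annotated or not. -/
def isCallRet (φ : Act St Method PComm) : Bool := φ.isCall || φ.isRet

/-- Erases the state annotation. -/
def ground : Act St Method PComm → Act St Method PComm
  | prim t c => prim t c
  | call t m _ => call t m none
  | ret t m _ => ret t m none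

/-- The action is an (annotated) interface action. -/
def IsInterface : Act St Method PComm → Prop
  | prim _ _ => False
  | call _ _ a => a.isSome
  | ret _ _ a => a.isSome

end Act

/-- Sequences of actions.  All sequences in the trace sets and denotations below have, for every
thread, alternating matching calls and returns starting from a call, since method bodies contain
no calls. -/
abbrev Trace (St Method PComm : Type*) := List (Act St Method PComm)

/-- The projection `τ|_t` of a trace to the actions of thread `t`. -/
def projThread (t : ThreadID) (τ : Trace St Method PComm) : Trace St Method PComm :=
  τ.filter (fun φ => φ.thread = t)

/-- The projection of a trace to call and return actions. -/
def history (τ : Trace St Method PComm) : Trace St Method PComm :=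
  τ.filter (fun φ => φ.isCallRet)

/-- Erases the state annotations of a trace. -/
def ground (τ : Trace St Method PComm) : Trace St Method PComm := τ.map Act.ground

/-- After the sequence of actions `pre`, thread `t` is inside a method: there is a call by `t`
in `pre` that is not followed by a return by `t`. -/
def InMethod (t : ThreadID) (pre : Trace St Method PComm) : Prop :=
  ∃ p m a s, pre = p ++ Act.call t m a :: s ∧ ∀ φ ∈ s, ¬ (φ.isRet = true ∧ φ.thread = t)

open Classical in
/-- Keeps the calls, the returns, and the primitive actions by threads that are not inside a
method; `pre` is the part of the trace already read. -/
noncomputable def clientAux (pre : Trace St Method PComm) :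
    Trace St Method PComm → Trace St Method PComm
  | [] => []
  | φ :: τ =>
    if φ.isCallRet = true ∨ ¬ InMethod φ.thread pre then φ :: clientAux (pre ++ [φ]) τ
    else clientAux (pre ++ [φ]) τ

/-- The projection `client(τ)` of a trace to client, call and return actions. -/
noncomputable def client (τ : Trace St Method PComm) : Trace St Method PComm := clientAux [] τ

/-- Equivalence `κ ∼ κ'` of client traces: the same projection to every thread, and the same
projection to primitive actions. -/
def ClientEquiv (κ κ' : Trace St Method PComm) : Prop :=
  (∀ t, projThread t κ = projThread t κ') ∧
    κ.filter (fun φ => !φ.isCallRet) = κ'.filter (fun φ => !φ.isCallRet)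

/-- The sequence consists of alternating calls and returns over matching methods and starts from
a call (or is empty). -/
def Alternating : Trace St Method PComm → Prop
  | [] => True
  | [φ] => φ.isCall
  | Act.call _ m _ :: Act.ret _ m' _ :: τ => m = m' ∧ Alternating τ
  | _ => False

/-- `H` is a history. -/
def IsHistory (H : Trace St Method PComm) : Prop :=
  (∀ φ ∈ H, φ.IsInterface) ∧ ∀ t, Alternating (projThread t H)

/-- `H` is linearized by `H'`. -/
def HistLin (H H' : Trace St Method PComm) : Prop :=
  ∃ ρ : Fin H.length ≃ Fin H'.length, ∀ i j,
    H.get i = H'.get (ρ i) ∧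
    ((i < j ∧ ((H.get i).thread = (H.get j).thread ∨
        ((H.get i).isRet = true ∧ (H.get j).isCall = true))) → ρ i < ρ j)

variable [SepAlgebra St]

/-- One step of the footprint tracking function: how an interface action changes the footprint
of the library. -/
def FpStep : Act St Method PComm → Set St → Set St → Prop
  | Act.call _ _ (some σ), l, l' => FpAdd l (footprint σ) l'
  | Act.ret _ _ (some σ), l, l' => FpSub l (footprint σ) l'
  | _, _, _ => False

/-- The graph of the partial function on footprints induced by a history. -/
def FpTrack : Trace St Method PComm → Set St → Set St → Prop
  | [], l, l' => l' = l
  | ψ :: H, l, l'' => ∃ l', FpStep ψ l l' ∧ FpTrack H l' l''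

/-- The history `H` is balanced from `l`. -/
def Balanced (H : Trace St Method PComm) (l : Set St) : Prop := ∃ l', FpTrack H l l'

/-- `ℋ` is an interface set: a set of pairs of a footprint and a history balanced from it. -/
def IsInterfaceSet (ℋ : Set (Set St × Trace St Method PComm)) : Prop :=
  ∀ l H, (l, H) ∈ ℋ → IsFootprint l ∧ IsHistory H ∧ Balanced H l

/-- Linearization lifted to interface sets. -/
def InterfLin (ℋ₁ ℋ₂ : Set (Set St × Trace St Method PComm)) : Prop :=
  ∀ l₁ H₁, (l₁, H₁) ∈ ℋ₁ → ∃ l₂ H₂, (l₂, H₂) ∈ ℋ₂ ∧ FpLe l₂ l₁ ∧ HistLin H₁ H₂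

end Traces

/-! ## Programs -/

/-- Commands. -/
inductive Com (Method PComm : Type*) where
  | prim (c : PComm)
  | call (m : Method)
  | seq (C₁ C₂ : Com Method PComm)
  | choice (C₁ C₂ : Com Method PComm)
  | star (C : Com Method PComm)

/-- The set of methods called in a command. -/
def Com.calls {Method PComm : Type*} : Com Method PComm → Set Method
  | prim _ => ∅
  | call m => {m}
  | seq C₁ C₂ => C₁.calls ∪ C₂.calls
  | choice C₁ C₂ => C₁.calls ∪ C₂.calls
  | star C => C.calls

/-- A library `{m = C_m | m ∈ methods}`, without nested method calls.  The values of `body`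
outside `methods` are irrelevant. -/
structure Library (Method PComm : Type*) where
  methods : Finset Method
  body : Method → Com Method PComm
  no_calls : ∀ m ∈ methods, (body m).calls = ∅

/-- A client `let [-] in C₁ ∥ … ∥ Cₙ`; the thread with identifier `i + 1` runs `thread i`. -/
structure Client (Method PComm : Type*) where
  n : ℕ
  thread : Fin n → Com Method PComm

/-- The pre- and postcondition of a method: precise predicates parameterised by threads. -/
structure Triple (St : Type*) [SepAlgebra St] where
  pre : ThreadID → Set St
  post : ThreadID → Set St
  pre_precise : ∀ t, Precise (pre t)
  post_precise : ∀ t, Precise (post t)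

/-- Method specifications: at most one Hoare triple for each method. -/
abbrev MethodSpec (Method St : Type*) [SepAlgebra St] := Method → Option (Triple St)

/-- `L : Γ` is a specified open program: `Γ` specifies exactly the methods of `L`. -/
def Library.SpecifiedBy {Method PComm St : Type*} [SepAlgebra St]
    (L : Library Method PComm) (Γ : MethodSpec Method St) : Prop :=
  ∀ m, m ∈ L.methods ↔ (Γ m).isSome

/-- `Γ ⊢ C` is a specified open program: `Γ` specifies all the methods that `C` may call. -/
def Client.SpecifiedBy {Method PComm St : Type*} [SepAlgebra St]
    (C : Client Method PComm) (Γ : MethodSpec Method St) : Prop :=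
  ∀ i, ∀ m ∈ (C.thread i).calls, (Γ m).isSome

/-! ## Trace sets -/

section TraceSets

variable {St Method PComm : Type*}

/-- The trace set of a command run by thread `t`, where `η` gives the trace sets of method
bodies. -/
def Com.traces (t : ThreadID) (η : Method → ThreadID → Language (Act St Method PComm)) :
    Com Method PComm → Language (Act St Method PComm)
  | prim c => {[Act.prim t c]}
  | call m => {[Act.call t m none]} * η m t * {[Act.ret t m none]}
  | seq C₁ C₂ => C₁.traces t η * C₂.traces t η
  | choice C₁ C₂ => C₁.traces t η + C₂.traces t η
  | star C => KStar.kstar (C.traces t η)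

/-- Interleavings of one trace from each `T i`, performed by threads `1, …, n`. -/
def parTraces (n : ℕ) (T : Fin n → Language (Act St Method PComm)) :
    Set (Trace St Method PComm) :=
  {τ | (∀ φ ∈ τ, ∃ i : Fin n, φ.thread = i + 1) ∧ ∀ i : Fin n, projThread (i + 1) τ ∈ T i}

/-- Prefix closure. -/
def prefixClosure (T : Set (Trace St Method PComm)) : Set (Trace St Method PComm) :=
  {τ | ∃ τ' ∈ T, τ <+: τ'}

/-- The trace sets of the method bodies of a library. -/
def Library.bodies (L : Library Method PComm) (m : Method) (t : ThreadID) :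
    Language (Act St Method PComm) :=
  (L.body m).traces t (fun _ _ => 0)

/-- The trace set of the complete program obtained by filling the client with the library. -/
def completeTraces (C : Client Method PComm) (L : Library Method PComm) :
    Set (Trace St Method PComm) :=
  prefixClosure (parTraces C.n (fun i => (C.thread i).traces (i + 1) L.bodies))

/-- The trace set of the open program `Γ ⊢ C`. -/
def clientTraces (C : Client Method PComm) : Set (Trace St Method PComm) :=
  prefixClosure (parTraces C.n (fun i => (C.thread i).traces (i + 1) (fun _ _ => {[]})))

/-- The trace set of a thread `t` of the most general client `(m₁ + … + mⱼ)^*`. -/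
def Library.mgcTraces (L : Library Method PComm) (t : ThreadID) :
    Language (Act St Method PComm) :=
  KStar.kstar (α := Language (Act St Method PComm))
    {τ | ∃ m ∈ L.methods, τ ∈ (Com.call m : Com Method PComm).traces t L.bodies}

/-- The trace set of the open program `L : Γ`. -/
def libraryTraces (L : Library Method PComm) : Set (Trace St Method PComm) :=
  prefixClosure {τ | ∃ k ≥ 1, τ ∈ parTraces k (fun i => L.mgcTraces (i + 1))}

end TraceSets

/-! ## Evaluation -/

/-- Either a set of outcomes, or the error `⊤`. -/
inductive Res (α : Type*) where
  | fault
  | ok (s : Set α)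

/-- Membership in the set of outcomes. -/
def Res.Has {α : Type*} : Res α → α → Prop
  | fault, _ => False
  | ok s, x => x ∈ s

section Evaluation

variable {St Method PComm : Type*} [SepAlgebra St]

/-- The transformers of primitive commands preserve footprints. -/
def FootprintPreserving (f : PComm → ThreadID → St → Res St) : Prop :=
  ∀ c t σ σ', (f c t σ).Has σ' → footprint σ' = footprint σ

/-- Strong Locality of the transformers of primitive commands. -/
def StronglyLocal (f : PComm → ThreadID → St → Res St) : Prop :=
  ∀ c t σ₁ σ₂ σ S, op σ₁ σ₂ = some σ → f c t σ₁ = Res.ok S →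
    f c t σ = Res.ok (sepSet S {σ₂})

/-- Evaluation of a primitive command as an action. -/
def evalPrim (f : PComm → ThreadID → St → Res St) (t : ThreadID) (c : PComm) (σ : St) :
    Res (St × Act St Method PComm) :=
  match f c t σ with
  | Res.fault => Res.fault
  | Res.ok S => Res.ok {x | x.1 ∈ S ∧ x.2 = Act.prim t c}

/-- Receiving a piece of state satisfying `r`: `mk σ₁` is the action annotated with the piece
`σ₁` received. -/
def receive (r : Set St) (mk : St → Act St Method PComm) (σ : St) :
    Res (St × Act St Method PComm) :=
  Res.ok {x | ∃ σ₁ ∈ r, op σ σ₁ = some x.1 ∧ x.2 = mk σ₁}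

open Classical in
/-- Giving up the substate satisfying `r`, which is unique when `r` is precise; faults if there
is none.  `mk σ₁` is the action annotated with the piece `σ₁` given up. -/
noncomputable def giveUp (r : Set St) (mk : St → Act St Method PComm) (σ : St) :
    Res (St × Act St Method PComm) :=
  if ∃ σ₁ ∈ r, ∃ σ₂, op σ₁ σ₂ = some σ then
    Res.ok {x | ∃ σ₁ ∈ r, op σ₁ x.1 = some σ ∧ x.2 = mk σ₁}
  else Res.fault

/-- Evaluation of an action in a complete program. -/
def evalComplete (f : PComm → ThreadID → St → Res St) :
    Act St Method PComm → St → Res (St × Act St Method PComm)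
  | Act.prim t c, σ => evalPrim f t c σ
  | Act.call t m _, σ => Res.ok {(σ, Act.call t m none)}
  | Act.ret t m _, σ => Res.ok {(σ, Act.ret t m none)}

/-- Library-local evaluation of an action.  Calls and returns of unspecified methods, which do
not occur in specified programs, fault. -/
noncomputable def evalLibrary (f : PComm → ThreadID → St → Res St) (Γ : MethodSpec Method St) :
    Act St Method PComm → St → Res (St × Act St Method PComm)
  | Act.prim t c, σ => evalPrim f t c σ
  | Act.call t m _, σ =>
    match Γ m with
    | none => Res.fault
    | some T => receive (T.pre t) (fun σ₁ => Act.call t m (some σ₁)) σ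
  | Act.ret t m _, σ =>
    match Γ m with
    | none => Res.fault
    | some T => giveUp (T.post t) (fun σ₁ => Act.ret t m (some σ₁)) σ

/-- Client-local evaluation of an action.  Calls and returns of unspecified methods, which do
not occur in specified programs, fault. -/
noncomputable def evalClient (f : PComm → ThreadID → St → Res St) (Γ : MethodSpec Method St) :
    Act St Method PComm → St → Res (St × Act St Method PComm)
  | Act.prim t c, σ => evalPrim f t c σ
  | Act.call t m _, σ =>
    match Γ m with
    | none => Res.fault
    | some T => giveUp (T.pre t) (fun σ₁ => Act.call t m (some σ₁)) σ
  | Act.ret t m _, σ =>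
    match Γ m with
    | none => Res.fault
    | some T => receive (T.post t) (fun σ₁ => Act.ret t m (some σ₁)) σ

open Classical in
/-- Extending the evaluation of a trace by one action, evaluated by `ev`. -/
noncomputable def evalSnoc (ev : Act St Method PComm → St → Res (St × Act St Method PComm)) :
    Res (St × Trace St Method PComm) → Act St Method PComm → Res (St × Trace St Method PComm)
  | Res.fault, _ => Res.fault
  | Res.ok S, φ =>
    if ∃ x ∈ S, ev φ x.1 = Res.fault then Res.fault
    else Res.ok {y | ∃ x ∈ S, ∃ φ', (ev φ x.1).Has (y.1, φ') ∧ y.2 = x.2 ++ [φ']}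

/-- Evaluation of a trace from a state. -/
noncomputable def evalTrace (ev : Act St Method PComm → St → Res (St × Act St Method PComm))
    (τ : Trace St Method PComm) (σ : St) : Res (St × Trace St Method PComm) :=
  τ.foldl (evalSnoc ev) (Res.ok {(σ, [])})

open Classical in
/-- The denotation of a program with trace set `T`, at an initial state. -/
noncomputable def denote (ev : Act St Method PComm → St → Res (St × Act St Method PComm))
    (T : Set (Trace St Method PComm)) (σ : St) : Res (Trace St Method PComm) :=
  if ∃ τ ∈ T, evalTrace ev τ σ = Res.fault then Res.fault
  else Res.ok {τ' | ∃ τ ∈ T, ∃ σ', (evalTrace ev τ σ).Has (σ', τ')}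

/-- The denotation of the complete program `C(L)`. -/
noncomputable def denoteComplete (f : PComm → ThreadID → St → Res St)
    (C : Client Method PComm) (L : Library Method PComm) : St → Res (Trace St Method PComm) :=
  denote (evalComplete f) (completeTraces C L)

/-- The library-local denotation of `L : Γ`. -/
noncomputable def denoteLibrary (f : PComm → ThreadID → St → Res St)
    (L : Library Method PComm) (Γ : MethodSpec Method St) : St → Res (Trace St Method PComm) :=
  denote (evalLibrary f Γ) (libraryTraces L)

/-- The client-local denotation of `Γ ⊢ C`. -/
noncomputable def denoteClient (f : PComm → ThreadID → St → Res St)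
    (Γ : MethodSpec Method St) (C : Client Method PComm) : St → Res (Trace St Method PComm) :=
  denote (evalClient f Γ) (clientTraces C)

/-- A program with denotation `D` is safe for the set `I` of initial states. -/
def Safe (D : St → Res (Trace St Method PComm)) (I : Set St) : Prop :=
  ∀ σ ∈ I, D σ ≠ Res.fault

/-- The pairs of an initial state in `I` and a trace produced from it. -/
def behaviours (D : St → Res (Trace St Method PComm)) (I : Set St) :
    Set (St × Trace St Method PComm) :=
  {x | x.1 ∈ I ∧ (D x.1).Has x.2}

/-- The interface set of the library `L : Γ` run from initial states in `I`. -/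
def interf (f : PComm → ThreadID → St → Res St) (L : Library Method PComm)
    (Γ : MethodSpec Method St) (I : Set St) : Set (Set St × Trace St Method PComm) :=
  {x | ∃ σ₀ τ, (σ₀, τ) ∈ behaviours (denoteLibrary f L Γ) I ∧
    x = (footprint σ₀, history τ)}

end Evaluation

end OwnershipLin

/-! A run of the complete program is cut into a client run and a library run, and the client run is
then replayed in the order of a history from the interface set. No run of another library is needed:
the footprints tracked along the history suffice.

Decomposition. Write the initial state as `σc * σl`. Primitive actions outside methods act on the
client's part and those inside on the library's; strong locality treats the other part as a frame. A
call or return leaves the total state alone and only moves the boundary. The piece transferred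
exists because the side giving it up is safe, and the other side can take it because the total state
is defined. This yields safety and two local runs with equal histories (`SplitRun.step`,
`complete_split`).

Rearrangement. The common history is linearized by some `H`, balanced from a footprint below that of
`σl`. The client run is replayed with calls and returns in the order of `H` (`reorder`): a call
waits for the primitive actions that preceded it, a return is performed at once. A linearization
never moves a return behind a call that followed it, so relative to primitive actions calls are only
delayed and returns only advanced. Hence the client always owns its state at the corresponding point
of the original run times the pieces not yet given up or received early (`pending`).

It remains to see that these products are defined. Definedness depends only on footprints, so it is
enough to keep the client compatible with some state `y` whose footprint is the one reached by `H`;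
balancedness preserves this at calls and returns (`compat_of_fpAdd`, `compat_of_fpSub`). Primitive
actions preserve footprints, so they can be replayed with the pending pieces as a frame
(`run_primsBetween`, `run_reorder`). Primitive actions keep their order, and so does each thread,
because a client thread performs none inside a method (`reorder_pairwise`); this gives the
equivalence of traces. -/

namespace OwnershipLin

open SepAlgebra

/-! ### Partial products of states as a commutative monoid -/

section PartialMonoid

/-- Possibly undefined states: the operation of a separation algebra made total. -/
def PState (St : Type*) := Option St

/-- A state as a defined element of `PState`. -/
def PState.of {St : Type*} (x : St) : PState St := some x

/-- The element of `PState` is a state. -/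
def PState.IsDefined {St : Type*} (a : PState St) : Prop := ∃ x, a = PState.of x

variable {St : Type*} [SepAlgebra St]

/-- The undefined element absorbs everything, so every subproduct of a defined product is defined,
and rearranging partial products becomes rewriting in a commutative monoid. -/
instance : CommMonoid (PState St) where
  mul a b := Option.bind a fun x => Option.bind b fun y => op x y
  one := some e
  mul_assoc a b c := by
    change Option.bind (Option.bind a fun x => Option.bind b fun y => op x y)
        (fun x => Option.bind c fun y => op x y) =
      Option.bind a fun x => Option.bind (Option.bind b fun x => Option.bind c fun y => op x y)
        fun y => op x y
    rcases a with _ | a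
    · rfl
    rcases b with _ | b
    · rfl
    rcases c with _ | c
    · simp
    · simpa using op_assoc a b c
  one_mul a := by
    change Option.bind (some e) (fun x => Option.bind a fun y => op x y) = a
    rcases a with _ | a
    · rfl
    · simpa using e_op a
  mul_one a := by
    change Option.bind a (fun x => Option.bind (some e) fun y => op x y) = a
    rcases a with _ | a
    · rfl
    · simpa [op_comm a e] using e_op a
  mul_comm a b := by
    change Option.bind a (fun x => Option.bind b fun y => op x y) =
      Option.bind b fun x => Option.bind a fun y => op x y
    rcases a with _ | a <;> rcases b with _ | b
    · rfl
    · rfl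
    · rfl
    · exact op_comm a b

open PState

theorem op_eq_some_iff {a b x : St} : op a b = some x ↔ of a * of b = of x := Iff.rfl

theorem compat_iff {a b : St} : Compat a b ↔ (of a * of b).IsDefined := Iff.rfl

theorem PState.IsDefined.of_mul_left {a b : PState St} (h : (a * b).IsDefined) :
    a.IsDefined := by
  rcases a with _ | a
  · obtain ⟨x, hx⟩ := h
    exact Option.noConfusion rfl (heq_of_eq (show (none : Option St) = some x from hx))
  · exact ⟨a, rfl⟩

theorem PState.IsDefined.of_mul_right {a b : PState St} (h : (a * b).IsDefined) :
    b.IsDefined := by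
  rw [mul_comm] at h
  exact h.of_mul_left

theorem mem_footprint_self (σ : St) : σ ∈ footprint σ := fun _ => Iff.rfl

theorem compat_of_footprint_eq {a b : St} (h : footprint a = footprint b) (c : St) :
    Compat a c ↔ Compat b c := by
  have : a ∈ footprint b := h ▸ mem_footprint_self a
  exact this c

/-- Whether a product is defined depends only on the footprints of its factors. The other factor `c`
may be a whole product, since it is a state as soon as the product is defined. -/
theorem PState.IsDefined.congr_footprint {a b : St} {c : PState St}
    (h : footprint a = footprint b) (hd : (of a * c).IsDefined) : (of b * c).IsDefined := by
  obtain ⟨y, rfl⟩ := hd.of_mul_right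
  exact (compat_of_footprint_eq h y).1 hd

end PartialMonoid

/-! ### Single runs versus evaluation of traces -/

section Runs

variable {St Method PComm : Type*}

/-- `Run ev σ τ σ' κ`: evaluating `τ` from `σ` may lead to `σ'`, producing the actions `κ`. -/
inductive Run (ev : Act St Method PComm → St → Res (St × Act St Method PComm)) :
    St → Trace St Method PComm → St → Trace St Method PComm → Prop
  | nil (σ : St) : Run ev σ [] σ []
  | cons {σ σ₁ σ' : St} {φ ψ : Act St Method PComm} {τ κ : Trace St Method PComm} :
      (ev φ σ).Has (σ₁, ψ) → Run ev σ₁ τ σ' κ → Run ev σ (φ :: τ) σ' (ψ :: κ)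

variable {ev : Act St Method PComm → St → Res (St × Act St Method PComm)}

theorem Run.append {σ σ₁ σ₂ : St} {τ₁ τ₂ κ₁ κ₂ : Trace St Method PComm}
    (h₁ : Run ev σ τ₁ σ₁ κ₁) (h₂ : Run ev σ₁ τ₂ σ₂ κ₂) :
    Run ev σ (τ₁ ++ τ₂) σ₂ (κ₁ ++ κ₂) := by
  induction h₁ with
  | nil => exact h₂
  | cons h _ ih => exact .cons h (ih h₂)

theorem Run.single {σ σ' : St} {φ ψ : Act St Method PComm} (h : (ev φ σ).Has (σ', ψ)) :
    Run ev σ [φ] σ' [ψ] := .cons h (.nil _)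

theorem Run.append_inv {σ σ₂ : St} {τ₁ τ₂ κ : Trace St Method PComm}
    (h : Run ev σ (τ₁ ++ τ₂) σ₂ κ) :
    ∃ σ₁ κ₁ κ₂, Run ev σ τ₁ σ₁ κ₁ ∧ Run ev σ₁ τ₂ σ₂ κ₂ ∧ κ = κ₁ ++ κ₂ := by
  induction τ₁ generalizing σ κ with
  | nil => exact ⟨σ, [], κ, .nil σ, h, rfl⟩
  | cons φ τ₁ ih =>
    cases h with
    | cons h h' =>
      obtain ⟨σ₁, κ₁, κ₂, r₁, r₂, rfl⟩ := ih h'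
      exact ⟨σ₁, _ :: κ₁, κ₂, .cons h r₁, r₂, rfl⟩

theorem Run.snoc_inv {σ σ₂ : St} {φ : Act St Method PComm} {τ κ : Trace St Method PComm}
    (h : Run ev σ (τ ++ [φ]) σ₂ κ) :
    ∃ σ₁ κ₁ ψ, Run ev σ τ σ₁ κ₁ ∧ (ev φ σ₁).Has (σ₂, ψ) ∧ κ = κ₁ ++ [ψ] := by
  obtain ⟨σ₁, κ₁, κ₂, r₁, r₂, rfl⟩ := h.append_inv
  cases r₂ with
  | cons hφ hnil =>
    cases hnil with
    | nil => exact ⟨σ₁, κ₁, _, r₁, hφ, rfl⟩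

/-- The intermediate states of a run. -/
theorem Run.exists_states {σ σ' : St} {τ κ : Trace St Method PComm} (h : Run ev σ τ σ' κ) :
    τ.length = κ.length ∧ ∃ s : ℕ → St, s 0 = σ ∧
      ∀ i φ ψ, τ[i]? = some φ → κ[i]? = some ψ → (ev φ (s i)).Has (s (i + 1), ψ) := by
  induction h with
  | nil σ => exact ⟨rfl, fun _ => σ, rfl, by simp⟩
  | @cons σ σ₁ σ' φ ψ τ κ h _ ih =>
    obtain ⟨hl, s, hs, ih⟩ := ih
    refine ⟨by simp [hl], fun i => Nat.casesOn i σ s, rfl, ?_⟩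
    rintro (_ | i) φ' ψ' h₁ h₂
    · simp only [List.getElem?_cons_zero, Option.some.injEq] at h₁ h₂
      subst h₁ h₂
      simpa [hs] using h
    · exact ih i φ' ψ' (by simpa using h₁) (by simpa using h₂)

theorem evalTrace_snoc (τ : Trace St Method PComm) (φ : Act St Method PComm) (σ : St) :
    evalTrace ev (τ ++ [φ]) σ = evalSnoc ev (evalTrace ev τ σ) φ := by
  simp [evalTrace]

theorem evalTrace_ne_fault_of_snoc {τ : Trace St Method PComm} {φ : Act St Method PComm} {σ : St}
    (h : evalTrace ev (τ ++ [φ]) σ ≠ Res.fault) : evalTrace ev τ σ ≠ Res.fault := by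
  intro h'
  rw [evalTrace_snoc, h'] at h
  exact h rfl

/-- One faulting branch discards the outcomes of all the others, so evaluation can be read branch by
branch once faults are excluded. -/
theorem evalTrace_has_iff {τ κ : Trace St Method PComm} {σ σ' : St}
    (h : evalTrace ev τ σ ≠ Res.fault) :
    (evalTrace ev τ σ).Has (σ', κ) ↔ Run ev σ τ σ' κ := by
  induction τ using List.reverseRecOn generalizing σ' κ with
  | nil =>
    constructor
    · intro h
      obtain ⟨rfl, rfl⟩ := Prod.mk.inj (show (σ', κ) = (σ, []) from h)
      exact .nil _
    · rintro ⟨⟩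
      exact rfl
  | append_singleton τ φ ih =>
    have h₀ := evalTrace_ne_fault_of_snoc h
    rw [evalTrace_snoc] at h ⊢
    cases hS : evalTrace ev τ σ with
    | fault => exact absurd hS h₀
    | ok S =>
      have ih' : ∀ σ₁ κ₁, (σ₁, κ₁) ∈ S ↔ Run ev σ τ σ₁ κ₁ := fun σ₁ κ₁ => by
        rw [← ih h₀, hS]; rfl
      rw [hS] at h
      simp only [evalSnoc] at h ⊢
      split_ifs at h ⊢ with hf
      · exact absurd rfl h
      · constructor
        · rintro ⟨⟨σ₁, κ₁⟩, hx, ψ, hev, hκ⟩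
          obtain rfl : κ = κ₁ ++ [ψ] := hκ
          exact ((ih' _ _).1 hx).append (.single hev)
        · intro hr
          obtain ⟨σ₁, κ₁, ψ, hr₁, hev, rfl⟩ := hr.snoc_inv
          exact ⟨(σ₁, κ₁), (ih' _ _).2 hr₁, ψ, hev, rfl⟩

theorem evalTrace_snoc_ne_fault_iff {τ : Trace St Method PComm} {φ : Act St Method PComm}
    {σ : St} : evalTrace ev (τ ++ [φ]) σ ≠ Res.fault ↔
      evalTrace ev τ σ ≠ Res.fault ∧ ∀ σ₁ κ₁, Run ev σ τ σ₁ κ₁ → ev φ σ₁ ≠ Res.fault := by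
  by_cases h₀ : evalTrace ev τ σ = Res.fault
  · simp only [h₀, ne_eq, not_true_eq_false, false_and, iff_false, not_not]
    rw [evalTrace_snoc, h₀]
    rfl
  · simp only [← evalTrace_has_iff h₀]
    rw [evalTrace_snoc]
    cases hS : evalTrace ev τ σ with
    | fault => exact absurd hS h₀
    | ok S =>
      simp only [evalSnoc]
      split_ifs with hf
      · obtain ⟨x, hx, hf⟩ := hf
        simp only [ne_eq, not_true_eq_false, false_iff, not_and, not_forall]
        exact fun _ => ⟨x.1, x.2, hx, not_not.2 hf⟩
      · simp only [ne_eq, reduceCtorEq, not_false_eq_true, true_and, true_iff]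
        exact fun σ₁ κ₁ h h' => hf ⟨_, h, h'⟩

theorem denote_ne_fault_iff {T : Set (Trace St Method PComm)} {σ : St} :
    denote ev T σ ≠ Res.fault ↔ ∀ τ ∈ T, evalTrace ev τ σ ≠ Res.fault := by
  unfold denote
  split_ifs with h
  · obtain ⟨τ, hτ, h⟩ := h
    simp only [ne_eq, not_true_eq_false, false_iff, not_forall]
    exact ⟨τ, hτ, not_not.2 h⟩
  · simp only [ne_eq, reduceCtorEq, not_false_eq_true, true_iff]
    exact fun τ hτ h' => h ⟨τ, hτ, h'⟩

theorem denote_has_iff {T : Set (Trace St Method PComm)} {σ : St} {κ : Trace St Method PComm}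
    (h : denote ev T σ ≠ Res.fault) :
    (denote ev T σ).Has κ ↔ ∃ τ ∈ T, ∃ σ', Run ev σ τ σ' κ := by
  have h' := denote_ne_fault_iff.1 h
  unfold denote at h ⊢
  split_ifs at h ⊢ with hf
  · exact absurd rfl h
  · constructor
    · rintro ⟨τ, hτ, σ', hr⟩
      exact ⟨τ, hτ, σ', (evalTrace_has_iff (h' τ hτ)).1 hr⟩
    · rintro ⟨τ, hτ, σ', hr⟩
      exact ⟨τ, hτ, σ', (evalTrace_has_iff (h' τ hτ)).2 hr⟩

end Runs

/-! ### Client and library projections of traces -/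

section Projections

variable {St Method PComm : Type*}

theorem Act.isCall_ground (φ : Act St Method PComm) : φ.ground.isCall = φ.isCall := by
  cases φ <;> rfl

theorem Act.isRet_ground (φ : Act St Method PComm) : φ.ground.isRet = φ.isRet := by
  cases φ <;> rfl

theorem Act.isCallRet_ground (φ : Act St Method PComm) : φ.ground.isCallRet = φ.isCallRet := by
  cases φ <;> rfl

theorem Act.thread_ground (φ : Act St Method PComm) : φ.ground.thread = φ.thread := by
  cases φ <;> rfl

theorem Act.not_isCall_of_isRet {φ : Act St Method PComm} (h : φ.isRet = true) :
    ¬ φ.isCall = true := by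
  cases φ <;> simp_all [Act.isRet, Act.isCall]

theorem not_inMethod_nil (t : ThreadID) : ¬ InMethod t ([] : Trace St Method PComm) := by
  rintro ⟨p, m, a, s, h, -⟩
  simp at h

/-- Makes `InMethod` a flag updated action by action, the form needed for inductions from the end of
a trace. -/
theorem inMethod_snoc_iff {t : ThreadID} {pre : Trace St Method PComm}
    {φ : Act St Method PComm} :
    InMethod t (pre ++ [φ]) ↔ (φ.isCall = true ∧ φ.thread = t) ∨
      (InMethod t pre ∧ ¬ (φ.isRet = true ∧ φ.thread = t)) := by
  constructor
  · rintro ⟨p, m, a, s, h, hs⟩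
    rcases List.eq_nil_or_concat s with rfl | ⟨s, ψ, rfl⟩
    · obtain ⟨-, h⟩ := List.append_inj' h rfl
      obtain rfl := List.singleton_inj.1 h
      exact .inl ⟨rfl, rfl⟩
    · rw [List.concat_eq_append, ← List.cons_append, ← List.append_assoc] at h
      obtain ⟨rfl, hφ⟩ := List.append_inj' h rfl
      obtain rfl := List.singleton_inj.1 hφ
      exact .inr ⟨⟨p, m, a, s, rfl, fun χ hχ => hs χ (by simp [hχ])⟩, hs φ (by simp)⟩
  · rintro (⟨h, rfl⟩ | ⟨⟨p, m, a, s, rfl, hs⟩, h⟩)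
    · cases φ with
      | call t m a => exact ⟨pre, m, a, [], rfl, by simp⟩
      | _ => simp [Act.isCall] at h
    · refine ⟨p, m, a, s ++ [φ], by simp, fun χ hχ => ?_⟩
      rcases List.mem_append.1 hχ with hχ | hχ
      · exact hs χ hχ
      · obtain rfl := List.mem_singleton.1 hχ
        exact h

theorem projThread_append (t : ThreadID) (τ₁ τ₂ : Trace St Method PComm) :
    projThread t (τ₁ ++ τ₂) = projThread t τ₁ ++ projThread t τ₂ := List.filter_append ..

theorem projThread_cons_of_eq {t : ThreadID} {φ : Act St Method PComm} (h : φ.thread = t)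
    (τ : Trace St Method PComm) : projThread t (φ :: τ) = φ :: projThread t τ :=
  List.filter_cons_of_pos (by simpa using h)

theorem projThread_cons_of_ne {t : ThreadID} {φ : Act St Method PComm} (h : φ.thread ≠ t)
    (τ : Trace St Method PComm) : projThread t (φ :: τ) = projThread t τ :=
  List.filter_cons_of_neg (by simpa using h)

theorem inMethod_projThread {t : ThreadID} {τ : Trace St Method PComm} :
    InMethod t (projThread t τ) ↔ InMethod t τ := by
  induction τ using List.reverseRecOn with
  | nil => rfl
  | append_singleton τ φ ih =>
    rw [projThread_append, inMethod_snoc_iff]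
    by_cases h : φ.thread = t
    · rw [projThread_cons_of_eq h, show projThread t [] = ([] : Trace St Method PComm) from rfl,
        inMethod_snoc_iff, ih]
    · rw [projThread_cons_of_ne h, show projThread t [] = ([] : Trace St Method PComm) from rfl,
        List.append_nil, ih]
      simp [h]

theorem inMethod_append_prims {t : ThreadID} {pre w : Trace St Method PComm}
    (hw : ∀ φ ∈ w, φ.isCallRet = false) : InMethod t (pre ++ w) ↔ InMethod t pre := by
  induction w using List.reverseRecOn with
  | nil => simp
  | append_singleton w φ ih =>
    have hφ := hw φ (by simp)
    simp only [Act.isCallRet, Bool.or_eq_false_iff] at hφ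
    rw [← List.append_assoc, inMethod_snoc_iff, ih fun φ h => hw φ (by simp [h])]
    simp [hφ.1, hφ.2]

open Classical in
/-- Keeps the calls, the returns, and the primitive actions whose being inside a method satisfies
`keep`; `pre` is the part of the trace already read. -/
noncomputable def selectAux (keep : Prop → Prop) (pre : Trace St Method PComm) :
    Trace St Method PComm → Trace St Method PComm
  | [] => []
  | φ :: τ =>
    if φ.isCallRet = true ∨ keep (InMethod φ.thread pre) then
      φ :: selectAux keep (pre ++ [φ]) τ
    else selectAux keep (pre ++ [φ]) τ

theorem clientAux_eq_selectAux (pre τ : Trace St Method PComm) :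
    clientAux pre τ = selectAux Not pre τ := by
  induction τ generalizing pre with
  | nil => rfl
  | cons φ τ ih =>
    simp only [clientAux, selectAux, ih]
    split_ifs <;> rfl

theorem client_eq_selectAux (τ : Trace St Method PComm) : client τ = selectAux Not [] τ :=
  clientAux_eq_selectAux [] τ

/-- The projection of a trace to call and return actions and the actions inside methods. -/
noncomputable def insideMethods (τ : Trace St Method PComm) : Trace St Method PComm :=
  selectAux id [] τ

theorem selectAux_append (keep : Prop → Prop) (pre τ₁ τ₂ : Trace St Method PComm) :
    selectAux keep pre (τ₁ ++ τ₂) = selectAux keep pre τ₁ ++ selectAux keep (pre ++ τ₁) τ₂ := by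
  induction τ₁ generalizing pre with
  | nil => simp [selectAux]
  | cons φ τ₁ ih =>
    simp only [List.cons_append, selectAux, ih]
    split_ifs <;> simp

theorem selectAux_prefix (keep : Prop → Prop) {pre τ₁ τ₂ : Trace St Method PComm}
    (h : τ₁ <+: τ₂) : selectAux keep pre τ₁ <+: selectAux keep pre τ₂ := by
  obtain ⟨τ, rfl⟩ := h
  rw [selectAux_append]
  exact List.prefix_append ..

theorem selectAux_subset (keep : Prop → Prop) {pre τ : Trace St Method PComm}
    {φ : Act St Method PComm} (h : φ ∈ selectAux keep pre τ) : φ ∈ τ := by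
  induction τ generalizing pre with
  | nil => exact h
  | cons ψ τ ih =>
    rw [selectAux] at h
    split_ifs at h
    · rcases List.mem_cons.1 h with rfl | h
      · simp
      · exact List.mem_cons_of_mem _ (ih h)
    · exact List.mem_cons_of_mem _ (ih h)

/-- A thread's own actions decide whether it is inside a method (`inMethod_projThread`). Facts about
interleavings thereby reduce to single threads. -/
theorem projThread_selectAux (keep : Prop → Prop) (t : ThreadID)
    (pre τ : Trace St Method PComm) :
    projThread t (selectAux keep pre τ) = selectAux keep (projThread t pre) (projThread t τ) := by
  induction τ generalizing pre with
  | nil => rfl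
  | cons φ τ ih =>
    by_cases h : φ.thread = t
    · subst h
      have hp : projThread φ.thread (pre ++ [φ]) = projThread φ.thread pre ++ [φ] := by
        rw [projThread_append, projThread_cons_of_eq rfl]; rfl
      rw [projThread_cons_of_eq rfl]
      simp only [selectAux, ← hp, ← ih]
      by_cases hk : φ.isCallRet = true ∨ keep (InMethod φ.thread pre)
      · rw [if_pos hk, if_pos (by rwa [inMethod_projThread]), projThread_cons_of_eq rfl]
      · rw [if_neg hk, if_neg (by rwa [inMethod_projThread])]
    · have hp : projThread t (pre ++ [φ]) = projThread t pre := by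
        rw [projThread_append, projThread_cons_of_ne h]
        exact List.append_nil _
      rw [projThread_cons_of_ne h, ← hp, ← ih, selectAux]
      split_ifs
      · rw [projThread_cons_of_ne h]
      · rfl

theorem selectAux_prims_of_keep {keep : Prop → Prop} {t : ThreadID}
    {pre w : Trace St Method PComm} (hw : ∀ φ ∈ w, φ.isCallRet = false ∧ φ.thread = t)
    (h : keep (InMethod t pre)) : selectAux keep pre w = w := by
  induction w generalizing pre with
  | nil => rfl
  | cons φ w ih =>
    have hφ := hw φ (by simp)
    have hi : InMethod t (pre ++ [φ]) ↔ InMethod t pre :=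
      inMethod_append_prims (by simpa using hφ.1)
    rw [selectAux, hφ.2, if_pos (.inr h), ih (fun φ h => hw φ (by simp [h])) (by rwa [hi])]

theorem selectAux_prims_of_not_keep {keep : Prop → Prop} {t : ThreadID}
    {pre w : Trace St Method PComm} (hw : ∀ φ ∈ w, φ.isCallRet = false ∧ φ.thread = t)
    (h : ¬ keep (InMethod t pre)) : selectAux keep pre w = [] := by
  induction w generalizing pre with
  | nil => rfl
  | cons φ w ih =>
    have hφ := hw φ (by simp)
    have hi : InMethod t (pre ++ [φ]) ↔ InMethod t pre :=
      inMethod_append_prims (by simpa using hφ.1)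
    rw [selectAux, hφ.2, if_neg (by simp [hφ.1, h]),
      ih (fun φ h => hw φ (by simp [h])) (by rwa [hi])]

end Projections

/-! ### Trace sets of the client and of the library -/

section Syntactic

variable {St Method PComm : Type*}

theorem Com.traces_of_calls_eq_empty {t : ThreadID}
    {η : Method → ThreadID → Language (Act St Method PComm)} {C : Com Method PComm}
    (hC : C.calls = ∅) {w : Trace St Method PComm} (hw : w ∈ C.traces t η) :
    ∀ φ ∈ w, φ.isCallRet = false ∧ φ.thread = t := by
  induction C generalizing w with
  | prim c =>
    obtain rfl : w = [Act.prim t c] := hw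
    simp [Act.isCallRet, Act.isCall, Act.isRet, Act.thread]
  | call m => simp [Com.calls] at hC
  | seq C₁ C₂ ih₁ ih₂ =>
    simp only [Com.calls, Set.union_empty_iff] at hC
    obtain ⟨w₁, h₁, w₂, h₂, rfl⟩ := Language.mem_mul.1 hw
    intro φ hφ
    rcases List.mem_append.1 hφ with hφ | hφ
    · exact ih₁ hC.1 h₁ φ hφ
    · exact ih₂ hC.2 h₂ φ hφ
  | choice C₁ C₂ ih₁ ih₂ =>
    simp only [Com.calls, Set.union_empty_iff] at hC
    rcases hw with hw | hw
    · exact ih₁ hC.1 hw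
    · exact ih₂ hC.2 hw
  | star C ih =>
    obtain ⟨ws, rfl, h⟩ := Language.mem_kstar.1 hw
    intro φ hφ
    obtain ⟨w, hw, hφ⟩ := List.mem_flatten.1 hφ
    exact ih hC (h w hw) φ hφ

theorem append_mem_kstar {α : Type*} {l : Language α} {a b : List α}
    (ha : a ∈ KStar.kstar l) (hb : b ∈ KStar.kstar l) : a ++ b ∈ KStar.kstar l := by
  obtain ⟨L₁, rfl, h₁⟩ := Language.mem_kstar.1 ha
  obtain ⟨L₂, rfl, h₂⟩ := Language.mem_kstar.1 hb
  rw [← List.flatten_append]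
  refine Language.join_mem_kstar fun y hy => ?_
  rcases List.mem_append.1 hy with hy | hy
  exacts [h₁ y hy, h₂ y hy]

theorem mem_kstar_of_mem {α : Type*} {l : Language α} {a : List α} (ha : a ∈ l) :
    a ∈ KStar.kstar l := by
  simpa using Language.join_mem_kstar (L := [a]) (by simpa using ha)

theorem inMethod_call_append {t : ThreadID} (m : Method) (a : Option St)
    (pre : Trace St Method PComm) : InMethod t (pre ++ [Act.call t m a]) :=
  inMethod_snoc_iff.2 (.inl ⟨rfl, rfl⟩)

theorem not_inMethod_ret_append {t : ThreadID} (m : Method) (a : Option St)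
    (pre : Trace St Method PComm) : ¬ InMethod t (pre ++ [Act.ret t m a]) := by
  rw [inMethod_snoc_iff]
  simp [Act.isCall, Act.isRet, Act.thread]

/-- An execution of a command by a thread, split into the client and the library parts. -/
theorem Com.traces_split (L : Library Method PComm) {t : ThreadID} {C : Com Method PComm}
    (hC : ∀ m ∈ C.calls, m ∈ L.methods) {w pre : Trace St Method PComm}
    (hw : w ∈ C.traces t L.bodies) (hpre : ¬ InMethod t pre) :
    ¬ InMethod t (pre ++ w) ∧ selectAux Not pre w ∈ C.traces t (fun _ _ => {[]}) ∧
      selectAux id pre w ∈ L.mgcTraces t := by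
  -- Executions of commands begin and end outside methods, which is what allows their projections to
  -- be composed.
  induction C generalizing w pre with
  | prim c =>
    obtain rfl : w = [Act.prim t c] := hw
    have hp : ∀ φ ∈ [(Act.prim t c : Act St Method PComm)],
        φ.isCallRet = false ∧ φ.thread = t := by
      simp [Act.isCallRet, Act.isCall, Act.isRet, Act.thread]
    refine ⟨by rwa [inMethod_append_prims fun φ h => (hp φ h).1], ?_, ?_⟩
    · rw [selectAux_prims_of_keep hp hpre]
      exact rfl
    · rw [selectAux_prims_of_not_keep hp hpre]
      exact Language.nil_mem_kstar _
  | call m =>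
    have hm : m ∈ L.methods := hC m rfl
    obtain ⟨w₁, h₁, w₂, rfl : w₂ = [Act.ret t m none], rfl⟩ := Language.mem_mul.1 hw
    obtain ⟨w₀, rfl : w₀ = [Act.call t m none], w, hb, rfl⟩ := Language.mem_mul.1 h₁
    -- The body contains no calls or returns, so it lies wholly inside the method: the client
    -- projection drops all of it and the library projection keeps all of it.
    have hb' := Com.traces_of_calls_eq_empty (L.no_calls m hm) hb
    have hin := inMethod_call_append (t := t) m none pre
    have hcr : ∀ (keep : Prop → Prop), selectAux keep pre
        (([Act.call t m none] ++ w) ++ [Act.ret t m none]) =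
          [Act.call t m none] ++ selectAux keep (pre ++ [Act.call t m none]) w ++
            [Act.ret t m none] := by
      intro keep
      rw [selectAux_append, selectAux_append]
      simp [selectAux, Act.isCallRet, Act.isCall, Act.isRet]
    refine ⟨?_, ?_, ?_⟩
    · rw [← List.append_assoc]
      exact not_inMethod_ret_append m none _
    · rw [hcr, selectAux_prims_of_not_keep hb' (not_not.2 hin)]
      exact Language.append_mem_mul (Language.append_mem_mul rfl rfl) rfl
    · rw [hcr, selectAux_prims_of_keep hb' hin]
      exact mem_kstar_of_mem ⟨m, hm, Language.append_mem_mul (Language.append_mem_mul rfl hb) rfl⟩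
  | seq C₁ C₂ ih₁ ih₂ =>
    obtain ⟨w₁, h₁, w₂, h₂, rfl⟩ := Language.mem_mul.1 hw
    obtain ⟨a₁, b₁, c₁⟩ := ih₁ (fun m h => hC m (.inl h)) h₁ hpre
    obtain ⟨a₂, b₂, c₂⟩ := ih₂ (fun m h => hC m (.inr h)) h₂ a₁
    rw [← List.append_assoc, selectAux_append, selectAux_append]
    exact ⟨a₂, Language.append_mem_mul b₁ b₂, append_mem_kstar c₁ c₂⟩
  | choice C₁ C₂ ih₁ ih₂ =>
    rcases hw with hw | hw
    · obtain ⟨a, b, c⟩ := ih₁ (fun m h => hC m (.inl h)) hw hpre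
      exact ⟨a, .inl b, c⟩
    · obtain ⟨a, b, c⟩ := ih₂ (fun m h => hC m (.inr h)) hw hpre
      exact ⟨a, .inr b, c⟩
  | star C ih =>
    obtain ⟨ws, rfl, hws⟩ := Language.mem_kstar.1 hw
    clear hw
    induction ws generalizing pre with
    | nil => exact ⟨by simpa using hpre, Language.nil_mem_kstar _, Language.nil_mem_kstar _⟩
    | cons w ws ihs =>
      obtain ⟨a₁, b₁, c₁⟩ := ih hC (hws w (by simp)) hpre
      obtain ⟨a₂, b₂, c₂⟩ := ihs a₁ (fun y hy => hws y (by simp [hy]))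
      rw [List.flatten_cons, ← List.append_assoc, selectAux_append, selectAux_append]
      exact ⟨a₂, append_mem_kstar (mem_kstar_of_mem b₁) b₂, append_mem_kstar c₁ c₂⟩

theorem client_and_insideMethods_mem_traces {C : Client Method PComm}
    {L : Library Method PComm} (hC : ∀ i, ∀ m ∈ (C.thread i).calls, m ∈ L.methods)
    {τ : Trace St Method PComm} (hτ : τ ∈ completeTraces C L) :
    client τ ∈ clientTraces C ∧ insideMethods τ ∈ libraryTraces L := by
  obtain ⟨τ', ⟨hth, hpar⟩, hpre⟩ := hτ
  have key := fun i => Com.traces_split L (hC i) (hpar i) (not_inMethod_nil _)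
  constructor
  · refine ⟨client τ', ⟨fun φ hφ => ?_, fun i => ?_⟩, ?_⟩
    · rw [client_eq_selectAux] at hφ
      exact hth φ (selectAux_subset _ hφ)
    · rw [client_eq_selectAux, projThread_selectAux]
      exact (key i).2.1
    · rw [client_eq_selectAux, client_eq_selectAux]
      exact selectAux_prefix _ hpre
  · refine ⟨insideMethods τ', ⟨C.n + 1, by omega, fun φ hφ => ?_, fun i => ?_⟩,
      selectAux_prefix _ hpre⟩
    · obtain ⟨i, hi⟩ := hth φ (selectAux_subset _ hφ)
      exact ⟨i.castSucc, hi⟩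
    · by_cases hi : (i : ℕ) < C.n
      · rw [insideMethods, projThread_selectAux]
        exact (key ⟨i, hi⟩).2.2
      · have : projThread (i + 1) (insideMethods τ') = [] := by
          refine List.filter_eq_nil_iff.2 fun φ hφ => ?_
          obtain ⟨j, hj⟩ := hth φ (selectAux_subset _ hφ)
          have := j.2
          rw [decide_eq_true_eq, hj]
          exact fun h => hi (by have := Nat.add_right_cancel h; omega)
        rw [this]
        exact Language.nil_mem_kstar _

/-- Primitive actions occur outside methods and returns inside them. -/
def CallsWellFormed (pre : Trace St Method PComm) : Trace St Method PComm → Prop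
  | [] => True
  | φ :: τ => (φ.isCallRet = false → ¬ InMethod φ.thread pre) ∧
      (φ.isRet = true → InMethod φ.thread pre) ∧ CallsWellFormed (pre ++ [φ]) τ

theorem callsWellFormed_append {pre τ₁ τ₂ : Trace St Method PComm} :
    CallsWellFormed pre (τ₁ ++ τ₂) ↔
      CallsWellFormed pre τ₁ ∧ CallsWellFormed (pre ++ τ₁) τ₂ := by
  induction τ₁ generalizing pre with
  | nil => simp [CallsWellFormed]
  | cons φ τ₁ ih => simp [CallsWellFormed, ih, and_assoc]

/-- With empty bodies, each call is immediately followed by its return in the thread, leaving no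
room for a primitive action between them. -/
theorem Com.callsWellFormed_of_mem_traces {t : ThreadID} {C : Com Method PComm}
    {w pre : Trace St Method PComm} (hw : w ∈ C.traces t (fun _ _ => {[]}))
    (hpre : ¬ InMethod t pre) : ¬ InMethod t (pre ++ w) ∧ CallsWellFormed pre w := by
  induction C generalizing w pre with
  | prim c =>
    obtain rfl : w = [Act.prim t c] := hw
    refine ⟨?_, fun _ => hpre, by simp [Act.isRet], trivial⟩
    rw [inMethod_snoc_iff]
    simp [Act.isCall, hpre]
  | call m =>
    obtain ⟨w₁, h₁, w₂, rfl : w₂ = [Act.ret t m none], rfl⟩ := Language.mem_mul.1 hw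
    obtain ⟨w₀, rfl : w₀ = [Act.call t m none], w, rfl : w = [], rfl⟩ := Language.mem_mul.1 h₁
    refine ⟨?_, by simp [Act.isCallRet, Act.isCall], by simp [Act.isRet],
      by simp [Act.isCallRet, Act.isRet], fun _ => inMethod_call_append m none pre, trivial⟩
    rw [← List.append_assoc]
    exact not_inMethod_ret_append m none _
  | seq C₁ C₂ ih₁ ih₂ =>
    obtain ⟨w₁, h₁, w₂, h₂, rfl⟩ := Language.mem_mul.1 hw
    obtain ⟨a₁, b₁⟩ := ih₁ h₁ hpre
    obtain ⟨a₂, b₂⟩ := ih₂ h₂ a₁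
    rw [← List.append_assoc]
    exact ⟨a₂, callsWellFormed_append.2 ⟨b₁, b₂⟩⟩
  | choice C₁ C₂ ih₁ ih₂ =>
    rcases hw with hw | hw
    exacts [ih₁ hw hpre, ih₂ hw hpre]
  | star C ih =>
    obtain ⟨ws, rfl, hws⟩ := Language.mem_kstar.1 hw
    clear hw
    induction ws generalizing pre with
    | nil => exact ⟨by simpa using hpre, trivial⟩
    | cons w ws ihs =>
      obtain ⟨a₁, b₁⟩ := ih (hws w (by simp)) hpre
      obtain ⟨a₂, b₂⟩ := ihs a₁ (fun y hy => hws y (by simp [hy]))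
      rw [List.flatten_cons, ← List.append_assoc]
      exact ⟨a₂, callsWellFormed_append.2 ⟨b₁, b₂⟩⟩

/-- In a trace of a client, a primitive action occurs when its thread is outside any method, and
a return when it is inside one. -/
theorem inMethod_of_mem_clientTraces {C : Client Method PComm} {p s : Trace St Method PComm}
    {φ : Act St Method PComm} (h : p ++ φ :: s ∈ clientTraces C) :
    (φ.isCallRet = false → ¬ InMethod φ.thread p) ∧
      (φ.isRet = true → InMethod φ.thread p) := by
  obtain ⟨u, ⟨hth, hpar⟩, r, rfl⟩ := h
  obtain ⟨i, hi⟩ := hth φ (by simp)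
  have := (Com.callsWellFormed_of_mem_traces (hpar i) (not_inMethod_nil _)).2
  rw [← hi, List.append_assoc, projThread_append, callsWellFormed_append, List.cons_append,
    projThread_cons_of_eq rfl, List.nil_append] at this
  obtain ⟨h₁, h₂, -⟩ := this.2
  rw [inMethod_projThread] at h₁ h₂
  exact ⟨h₁, h₂⟩

end Syntactic

/-! ### Splitting complete runs into client and library runs -/

section Decomposition

open PState

variable {St Method PComm : Type*} [SepAlgebra St] {f : PComm → ThreadID → St → Res St}
  {Γ : MethodSpec Method St}

omit [SepAlgebra St] in
theorem evalPrim_has_iff {t : ThreadID} {c : PComm} {σ σ' : St} {ψ : Act St Method PComm} :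
    (evalPrim f t c σ).Has (σ', ψ) ↔ (f c t σ).Has σ' ∧ ψ = Act.prim t c := by
  unfold evalPrim
  cases f c t σ with
  | fault => exact ⟨False.elim, fun h => h.1⟩
  | ok S => exact Iff.rfl

omit [SepAlgebra St] in
theorem evalPrim_eq_fault_iff {t : ThreadID} {c : PComm} {σ : St} :
    (evalPrim f t c σ : Res (St × Act St Method PComm)) = Res.fault ↔ f c t σ = Res.fault := by
  unfold evalPrim
  cases f c t σ <;> simp

theorem StronglyLocal.ne_fault (hsl : StronglyLocal f) {c : PComm} {t : ThreadID}
    {σ₁ σ₂ σ : St} (hop : of σ = of σ₁ * of σ₂) (h : f c t σ₁ ≠ Res.fault) :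
    f c t σ ≠ Res.fault := by
  cases hS : f c t σ₁ with
  | fault => exact absurd hS h
  | ok S => simp [hsl c t σ₁ σ₂ σ S (op_eq_some_iff.2 hop.symm) hS]

theorem StronglyLocal.has_iff (hsl : StronglyLocal f) {c : PComm} {t : ThreadID}
    {σ₁ σ₂ σ : St} (hop : of σ = of σ₁ * of σ₂) (h : f c t σ₁ ≠ Res.fault) {σ' : St} :
    (f c t σ).Has σ' ↔ ∃ σ₁', (f c t σ₁).Has σ₁' ∧ of σ' = of σ₁' * of σ₂ := by
  cases hS : f c t σ₁ with
  | fault => exact absurd hS h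
  | ok S =>
    rw [hsl c t σ₁ σ₂ σ S (op_eq_some_iff.2 hop.symm) hS]
    constructor
    · rintro ⟨a, ha, b, rfl, hab⟩
      exact ⟨a, ha, (op_eq_some_iff.1 hab).symm⟩
    · rintro ⟨a, ha, hab⟩
      exact ⟨a, ha, σ₂, rfl, op_eq_some_iff.2 hab.symm⟩

theorem evalClient_call_ne_fault {t : ThreadID} {m : Method} {a : Option St} {σ : St}
    (h : evalClient f Γ (Act.call t m a) σ ≠ Res.fault) :
    ∃ T σ₁ σ₂, Γ m = some T ∧ σ₁ ∈ T.pre t ∧ of σ = of σ₁ * of σ₂ := by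
  unfold evalClient at h
  cases hT : Γ m with
  | none => simp [hT] at h
  | some T =>
    simp only [hT, giveUp] at h
    split_ifs at h with h'
    · obtain ⟨σ₁, h₁, σ₂, h₂⟩ := h'
      exact ⟨T, σ₁, σ₂, rfl, h₁, (op_eq_some_iff.1 h₂).symm⟩
    · exact absurd rfl h

theorem evalClient_call_has_iff {t : ThreadID} {m : Method} {a : Option St} {σ σ' : St}
    {ψ : Act St Method PComm} :
    (evalClient f Γ (Act.call t m a) σ).Has (σ', ψ) ↔ ∃ T σ₁, Γ m = some T ∧ σ₁ ∈ T.pre t ∧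
      of σ = of σ₁ * of σ' ∧ ψ = Act.call t m (some σ₁) := by
  cases hT : Γ m with
  | none => simp [evalClient, hT, Res.Has]
  | some T =>
    simp only [evalClient, hT, giveUp]
    split_ifs with h'
    · constructor
      · rintro ⟨σ₁, h₁, h₂, h₃⟩
        exact ⟨T, σ₁, rfl, h₁, (op_eq_some_iff.1 h₂).symm, h₃⟩
      · rintro ⟨_, σ₁, ⟨⟩, h₁, h₂, h₃⟩
        exact ⟨σ₁, h₁, op_eq_some_iff.2 h₂.symm, h₃⟩
    · constructor
      · exact False.elim
      · rintro ⟨_, σ₁, ⟨⟩, h₁, h₂, h₃⟩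
        exact h' ⟨σ₁, h₁, σ', op_eq_some_iff.2 h₂.symm⟩

theorem evalClient_ret_has_iff {t : ThreadID} {m : Method} {a : Option St} {σ σ' : St}
    {ψ : Act St Method PComm} :
    (evalClient f Γ (Act.ret t m a) σ).Has (σ', ψ) ↔ ∃ T σ₁, Γ m = some T ∧ σ₁ ∈ T.post t ∧
      of σ' = of σ * of σ₁ ∧ ψ = Act.ret t m (some σ₁) := by
  cases hT : Γ m with
  | none => simp [evalClient, hT, Res.Has]
  | some T =>
    simp only [evalClient, hT]
    constructor
    · rintro ⟨σ₁, h₁, h₂, h₃⟩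
      exact ⟨T, σ₁, rfl, h₁, (op_eq_some_iff.1 h₂).symm, h₃⟩
    · rintro ⟨_, σ₁, ⟨⟩, h₁, h₂, h₃⟩
      exact ⟨σ₁, h₁, op_eq_some_iff.2 h₂.symm, h₃⟩

theorem evalLibrary_call_has {t : ThreadID} {m : Method} {a : Option St} {σ σ' σ₁ : St}
    {T : Triple St} (hT : Γ m = some T) (h₁ : σ₁ ∈ T.pre t) (h : of σ' = of σ * of σ₁) :
    (evalLibrary f Γ (Act.call t m a : Act St Method PComm) σ).Has
      (σ', Act.call t m (some σ₁)) := by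
  simp only [evalLibrary, hT]
  exact ⟨σ₁, h₁, op_eq_some_iff.2 h.symm, rfl⟩

theorem evalLibrary_ret_ne_fault {t : ThreadID} {m : Method} {a : Option St} {σ : St}
    (h : evalLibrary f Γ (Act.ret t m a) σ ≠ Res.fault) :
    ∃ T σ₁ σ₂, Γ m = some T ∧ σ₁ ∈ T.post t ∧ of σ = of σ₁ * of σ₂ := by
  unfold evalLibrary at h
  cases hT : Γ m with
  | none => simp [hT] at h
  | some T =>
    simp only [hT, giveUp] at h
    split_ifs at h with h'
    · obtain ⟨σ₁, h₁, σ₂, h₂⟩ := h'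
      exact ⟨T, σ₁, σ₂, rfl, h₁, (op_eq_some_iff.1 h₂).symm⟩
    · exact absurd rfl h

theorem evalLibrary_ret_has {t : ThreadID} {m : Method} {a : Option St} {σ σ' σ₁ : St}
    {T : Triple St} (hT : Γ m = some T) (h₁ : σ₁ ∈ T.post t) (h : of σ = of σ₁ * of σ') :
    (evalLibrary f Γ (Act.ret t m a : Act St Method PComm) σ).Has
      (σ', Act.ret t m (some σ₁)) := by
  simp only [evalLibrary, hT, giveUp]
  rw [if_pos ⟨σ₁, h₁, σ', op_eq_some_iff.2 h.symm⟩]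
  exact ⟨σ₁, h₁, op_eq_some_iff.2 h.symm, rfl⟩

omit [SepAlgebra St] in
theorem history_append (τ₁ τ₂ : Trace St Method PComm) :
    history (τ₁ ++ τ₂) = history τ₁ ++ history τ₂ := List.filter_append ..

omit [SepAlgebra St] in
theorem ground_append (τ₁ τ₂ : Trace St Method PComm) :
    ground (τ₁ ++ τ₂) = ground τ₁ ++ ground τ₂ := List.map_append ..

omit [SepAlgebra St] in
theorem selectAux_snoc_of_keep {keep : Prop → Prop} {τ : Trace St Method PComm}
    {φ : Act St Method PComm} (h : φ.isCallRet = true ∨ keep (InMethod φ.thread τ)) :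
    selectAux keep [] (τ ++ [φ]) = selectAux keep [] τ ++ [φ] := by
  rw [selectAux_append, selectAux, List.nil_append, if_pos h]
  rfl

omit [SepAlgebra St] in
theorem selectAux_snoc_of_not_keep {keep : Prop → Prop} {τ : Trace St Method PComm}
    {φ : Act St Method PComm} (h : ¬ (φ.isCallRet = true ∨ keep (InMethod φ.thread τ))) :
    selectAux keep [] (τ ++ [φ]) = selectAux keep [] τ := by
  rw [selectAux_append, selectAux, List.nil_append, if_neg h]
  exact List.append_nil _

omit [SepAlgebra St] in
/-- The trace sets of programs are closed under prefixes. -/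
theorem prefixClosure_of_append {T : Set (Trace St Method PComm)} {τ₁ τ₂ : Trace St Method PComm}
    (h : τ₁ ++ τ₂ ∈ prefixClosure T) : τ₁ ∈ prefixClosure T := by
  obtain ⟨τ, hτ, hp⟩ := h
  exact ⟨τ, hτ, (List.prefix_append ..).trans hp⟩

/-- A state of a run of a complete program is split into the states of runs of the client and
the library. -/
def SplitRun (f : PComm → ThreadID → St → Res St) (Γ : MethodSpec Method St) (σc σl : St)
    (τ : Trace St Method PComm) (σ : St) : Prop :=
  ∃ σc' σl' κ ξ, of σ = of σc' * of σl' ∧ Run (evalClient f Γ) σc (client τ) σc' κ ∧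
    Run (evalLibrary f Γ) σl (insideMethods τ) σl' ξ ∧ history κ = history ξ ∧
    ground κ = ground (client τ)

/-- A primitive action belongs to exactly one of the two projections, and the other part of the
state is its frame. At calls and returns the total state is unchanged: safety of the side giving up
supplies the piece, and regrouping the defined product shows that the other side can take it. -/
theorem SplitRun.step (hsl : StronglyLocal f) {σc σl σ : St} {τ : Trace St Method PComm}
    {φ : Act St Method PComm} (h : SplitRun f Γ σc σl τ σ)
    (hc : evalTrace (evalClient f Γ) (client (τ ++ [φ])) σc ≠ Res.fault)
    (hl : evalTrace (evalLibrary f Γ) (insideMethods (τ ++ [φ])) σl ≠ Res.fault) :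
    evalComplete f φ σ ≠ Res.fault ∧
      ∀ σ' ψ, (evalComplete f φ σ).Has (σ', ψ) → SplitRun f Γ σc σl (τ ++ [φ]) σ' := by
  obtain ⟨σc', σl', κ, ξ, hσ, rc, rl, hh, hg⟩ := h
  rw [client_eq_selectAux] at hc rc hg
  rw [insideMethods] at hl rl
  simp only [SplitRun, client_eq_selectAux, insideMethods]
  cases φ with
  | prim t c =>
    have hcr : ¬ (Act.prim t c : Act St Method PComm).isCallRet = true := Bool.false_ne_true
    by_cases hin : InMethod t τ
    · rw [selectAux_snoc_of_keep (keep := id) (τ := τ) (φ := Act.prim t c) (.inr hin)] at hl ⊢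
      rw [selectAux_snoc_of_not_keep (keep := Not) (τ := τ) (φ := Act.prim t c)
        (not_or.2 ⟨hcr, not_not.2 hin⟩)] at hc ⊢
      have hf : f c t σl' ≠ Res.fault := by
        have := (evalTrace_snoc_ne_fault_iff.1 hl).2 _ _ rl
        rwa [evalLibrary, ne_eq, evalPrim_eq_fault_iff] at this
      -- Inside a method the library's part is acted upon and the client's is the frame.
      rw [mul_comm] at hσ
      refine ⟨?_, fun σ' ψ hψ => ?_⟩
      · rw [evalComplete, ne_eq, evalPrim_eq_fault_iff]
        exact hsl.ne_fault hσ hf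
      · obtain ⟨hψ, -⟩ := evalPrim_has_iff.1 hψ
        obtain ⟨a, ha, hσ'⟩ := (hsl.has_iff hσ hf).1 hψ
        refine ⟨σc', a, κ, ξ ++ [Act.prim t c], by rw [hσ', mul_comm], rc,
          rl.append (.single (evalPrim_has_iff.2 ⟨ha, rfl⟩)), ?_, hg⟩
        rw [hh, history_append]
        exact (List.append_nil _).symm
    · rw [selectAux_snoc_of_not_keep (keep := id) (τ := τ) (φ := Act.prim t c)
        (not_or.2 ⟨hcr, hin⟩)] at hl ⊢
      rw [selectAux_snoc_of_keep (keep := Not) (τ := τ) (φ := Act.prim t c) (.inr hin)] at hc ⊢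
      have hf : f c t σc' ≠ Res.fault := by
        have := (evalTrace_snoc_ne_fault_iff.1 hc).2 _ _ rc
        rwa [evalClient, ne_eq, evalPrim_eq_fault_iff] at this
      refine ⟨?_, fun σ' ψ hψ => ?_⟩
      · rw [evalComplete, ne_eq, evalPrim_eq_fault_iff]
        exact hsl.ne_fault hσ hf
      · obtain ⟨hψ, -⟩ := evalPrim_has_iff.1 hψ
        obtain ⟨a, ha, hσ'⟩ := (hsl.has_iff hσ hf).1 hψ
        refine ⟨a, σl', κ ++ [Act.prim t c], ξ, hσ',
          rc.append (.single (evalPrim_has_iff.2 ⟨ha, rfl⟩)), rl, ?_, ?_⟩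
        · rw [← hh, history_append]
          exact List.append_nil _
        · rw [ground_append, ground_append, hg]
  | call t m a =>
    have hcr : (Act.call t m a : Act St Method PComm).isCallRet = true := rfl
    rw [selectAux_snoc_of_keep (.inl hcr)] at hc hl ⊢
    rw [selectAux_snoc_of_keep (.inl hcr)]
    refine ⟨by simp [evalComplete], fun σ' ψ hψ => ?_⟩
    obtain ⟨rfl, rfl⟩ := Prod.mk.inj (show (σ', ψ) = (σ, Act.call t m none) from hψ)
    obtain ⟨T, σ₁, σ₂, hT, h₁, h₂⟩ :=
      evalClient_call_ne_fault ((evalTrace_snoc_ne_fault_iff.1 hc).2 _ _ rc)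
    have hσ₂ : of σ' = of σ₂ * (of σl' * of σ₁) := by
      rw [hσ, h₂, mul_comm (of σ₁), mul_assoc, mul_comm (of σ₁)]
    -- A factor of a defined product is defined, so the library can receive `σ₁`.
    obtain ⟨y, hy⟩ := IsDefined.of_mul_right ⟨σ', hσ₂.symm⟩
    refine ⟨σ₂, y, κ ++ [Act.call t m (some σ₁)], ξ ++ [Act.call t m (some σ₁)], by rw [hσ₂, hy],
      rc.append (.single (evalClient_call_has_iff.2 ⟨T, σ₁, hT, h₁, h₂, rfl⟩)),
      rl.append (.single (evalLibrary_call_has hT h₁ hy.symm)), ?_, ?_⟩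
    · rw [history_append, history_append, hh]
    · rw [ground_append, ground_append, hg]
      rfl
  | ret t m a =>
    have hcr : (Act.ret t m a : Act St Method PComm).isCallRet = true := rfl
    rw [selectAux_snoc_of_keep (.inl hcr)] at hc hl ⊢
    rw [selectAux_snoc_of_keep (.inl hcr)]
    refine ⟨by simp [evalComplete], fun σ' ψ hψ => ?_⟩
    obtain ⟨rfl, rfl⟩ := Prod.mk.inj (show (σ', ψ) = (σ, Act.ret t m none) from hψ)
    obtain ⟨T, σ₁, σ₂, hT, h₁, h₂⟩ :=
      evalLibrary_ret_ne_fault ((evalTrace_snoc_ne_fault_iff.1 hl).2 _ _ rl)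
    have hσ₂ : of σ' = (of σc' * of σ₁) * of σ₂ := by rw [hσ, h₂, mul_assoc]
    obtain ⟨y, hy⟩ := IsDefined.of_mul_left ⟨σ', hσ₂.symm⟩
    refine ⟨y, σ₂, κ ++ [Act.ret t m (some σ₁)], ξ ++ [Act.ret t m (some σ₁)], by rw [hσ₂, hy],
      rc.append (.single (evalClient_ret_has_iff.2 ⟨T, σ₁, hT, h₁, hy.symm, rfl⟩)),
      rl.append (.single (evalLibrary_ret_has hT h₁ h₂)), ?_, ?_⟩
    · rw [history_append, history_append, hh]
    · rw [ground_append, ground_append, hg]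
      rfl

/-- Complete programs are safe, and their runs split into runs of the client and the library. -/
theorem complete_split (hsl : StronglyLocal f) {C : Client Method PComm}
    {L : Library Method PComm} (hC : ∀ i, ∀ m ∈ (C.thread i).calls, m ∈ L.methods)
    {σ σc σl : St} (hσ : of σ = of σc * of σl)
    (hc : denoteClient f Γ C σc ≠ Res.fault) (hl : denoteLibrary f L Γ σl ≠ Res.fault)
    {τ : Trace St Method PComm} (hτ : τ ∈ completeTraces C L) :
    evalTrace (evalComplete f) τ σ ≠ Res.fault ∧
      ∀ σ' τ', Run (evalComplete f) σ τ σ' τ' → SplitRun f Γ σc σl τ σ' := by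
  have hc' := denote_ne_fault_iff.1 hc
  have hl' := denote_ne_fault_iff.1 hl
  induction τ using List.reverseRecOn with
  | nil =>
    refine ⟨by simp [evalTrace], fun σ' τ' hr => ?_⟩
    cases hr
    exact ⟨σc, σl, [], [], hσ, .nil _, .nil _, rfl, rfl⟩
  | append_singleton τ φ ih =>
    obtain ⟨h₁, h₂⟩ := ih (prefixClosure_of_append hτ)
    obtain ⟨hcτ, hlτ⟩ := client_and_insideMethods_mem_traces hC hτ
    refine ⟨evalTrace_snoc_ne_fault_iff.2 ⟨h₁, fun σ₁ κ₁ hr => ?_⟩, fun σ' τ' hr => ?_⟩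
    · exact ((h₂ _ _ hr).step hsl (hc' _ hcτ) (hl' _ hlτ)).1
    · obtain ⟨σ₁, κ₁, ψ, hr, hev, -⟩ := hr.snoc_inv
      exact ((h₂ _ _ hr).step hsl (hc' _ hcτ) (hl' _ hlτ)).2 _ _ hev

omit [SepAlgebra St] in
theorem Run.ground_eq_of_complete {σ σ' : St} {τ τ' : Trace St Method PComm}
    (h : Run (evalComplete f) σ τ σ' τ') : τ' = ground τ := by
  induction h with
  | nil => rfl
  | @cons σ σ₁ σ' φ ψ τ κ h _ ih =>
    rw [ih, ground, ground, List.map_cons]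
    congr 1
    cases φ with
    | prim t c => exact (evalPrim_has_iff.1 h).2
    | call t m a => exact (Prod.mk.inj (show (σ₁, ψ) = (σ, Act.call t m none) from h)).2
    | ret t m a => exact (Prod.mk.inj (show (σ₁, ψ) = (σ, Act.ret t m none) from h)).2

omit [SepAlgebra St] in
theorem inMethod_ground {t : ThreadID} {τ : Trace St Method PComm} :
    InMethod t (ground τ) ↔ InMethod t τ := by
  induction τ using List.reverseRecOn with
  | nil => rfl
  | append_singleton τ φ ih =>
    rw [ground_append, show ground [φ] = [φ.ground] from rfl, inMethod_snoc_iff,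
      inMethod_snoc_iff, ih, Act.isCall_ground, Act.isRet_ground, Act.thread_ground]

omit [SepAlgebra St] in
theorem client_ground (τ : Trace St Method PComm) : client (ground τ) = ground (client τ) := by
  rw [client_eq_selectAux, client_eq_selectAux]
  induction τ using List.reverseRecOn with
  | nil => rfl
  | append_singleton τ φ ih =>
    rw [ground_append, show ground [φ] = [φ.ground] from rfl]
    have hiff : φ.ground.isCallRet = true ∨ ¬ InMethod φ.ground.thread (ground τ) ↔
        φ.isCallRet = true ∨ ¬ InMethod φ.thread τ := by
      rw [Act.isCallRet_ground, Act.thread_ground, inMethod_ground]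
    by_cases h : φ.isCallRet = true ∨ ¬ InMethod φ.thread τ
    · rw [selectAux_snoc_of_keep h, selectAux_snoc_of_keep (hiff.2 h), ih, ground_append]
      rfl
    · rw [selectAux_snoc_of_not_keep h, selectAux_snoc_of_not_keep (mt hiff.1 h), ih]

end Decomposition

/-! ### Combinatorics of the reordering -/

section Reordering

variable {St Method PComm : Type*}

/-- The positions in `[a, b)` of primitive actions. -/
def primsBetween (A : ℕ → Act St Method PComm) (a b : ℕ) : List ℕ :=
  (List.range' a (b - a)).filter fun i => !(A i).isCallRet

/-- Reorders the positions of a trace `A 0, …, A (N - 1)` so that the calls and returns come in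
the order of the list: a call is preceded by the primitive actions preceding it in the trace that
have not yet been performed (those from `ptr` on), a return is performed at once. -/
def reorder (N : ℕ) (A : ℕ → Act St Method PComm) : ℕ → List ℕ → List ℕ
  | ptr, [] => primsBetween A ptr N
  | ptr, i :: h =>
    if (A i).isCall = true then
      primsBetween A ptr (max ptr (i + 1)) ++ i :: reorder N A (max ptr (i + 1)) h
    else i :: reorder N A ptr h

variable {N : ℕ} {A : ℕ → Act St Method PComm}

theorem mem_primsBetween {a b i : ℕ} :
    i ∈ primsBetween A a b ↔ (a ≤ i ∧ i < b) ∧ (A i).isCallRet = false := by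
  simp only [primsBetween, List.mem_filter, List.mem_range'_1, Bool.not_eq_true']
  refine and_congr_left fun _ => ?_
  omega

theorem primsBetween_pairwise (a b : ℕ) : (primsBetween A a b).Pairwise (· < ·) :=
  (List.pairwise_lt_range' (s := a) (n := b - a)).filter _

theorem primsBetween_append {a b c : ℕ} (hab : a ≤ b) (hbc : b ≤ c) :
    primsBetween A a b ++ primsBetween A b c = primsBetween A a c := by
  rw [primsBetween, primsBetween, primsBetween, ← List.filter_append]
  congr 1
  have := List.range'_append_1 (s := a) (m := b - a) (n := c - b)
  rw [show a + (b - a) = b by omega] at this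
  rw [this]
  congr 1
  omega

theorem primsBetween_succ_of_prim {a b : ℕ} (hab : a ≤ b) (h : (A b).isCallRet = false) :
    primsBetween A a (b + 1) = primsBetween A a b ++ [b] := by
  rw [← primsBetween_append hab (Nat.le_succ b)]
  simp [primsBetween, h]

theorem primsBetween_succ_of_callRet {a b : ℕ} (hab : a ≤ b) (h : (A b).isCallRet = true) :
    primsBetween A a (b + 1) = primsBetween A a b := by
  rw [← primsBetween_append hab (Nat.le_succ b)]
  simp [primsBetween, h]

theorem primsBetween_self (a : ℕ) : primsBetween A a a = [] := by
  simp [primsBetween]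

theorem filter_callRet_primsBetween (a b : ℕ) :
    (primsBetween A a b).filter (fun i => (A i).isCallRet) = [] := by
  refine List.filter_eq_nil_iff.2 fun i hi => ?_
  simp [(mem_primsBetween.1 hi).2]

theorem filter_prim_primsBetween (a b : ℕ) :
    (primsBetween A a b).filter (fun i => !(A i).isCallRet) = primsBetween A a b := by
  refine List.filter_eq_self.2 fun i hi => ?_
  simp [(mem_primsBetween.1 hi).2]

/-- Invariant of the reordering: `h` is the list of the calls and returns still to be performed,
and the primitive actions before `ptr` have been performed. -/
structure ReorderInv (N : ℕ) (A : ℕ → Act St Method PComm) (ptr : ℕ) (h : List ℕ) : Prop where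
  le : ptr ≤ N
  lt : ∀ i ∈ h, i < N
  callRet : ∀ i ∈ h, (A i).isCallRet = true
  nodup : h.Nodup
  calls : ∀ j, ptr ≤ j → j < N → (A j).isCall = true → j ∈ h
  rets : ∀ j ∈ h, (A j).isRet = true → ptr ≤ j
  closed : ∀ b ∈ h, ∀ r, b < r → r < N → (A r).isCallRet = true →
    (A b).thread = (A r).thread → r ∈ h
  order : h.Pairwise fun a b => (A a).thread = (A b).thread ∨
    ((A b).isRet = true ∧ (A a).isCall = true) → a < b

theorem Act.isRet_of_callRet {φ : Act St Method PComm} (h : φ.isCallRet = true)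
    (hc : ¬ φ.isCall = true) : φ.isRet = true := by
  cases φ <;> simp_all [Act.isCallRet, Act.isCall, Act.isRet]

theorem Act.isCallRet_of_isCall {φ : Act St Method PComm} (h : φ.isCall = true) :
    φ.isCallRet = true := by
  simp [Act.isCallRet, h]

theorem Act.isCallRet_of_isRet {φ : Act St Method PComm} (h : φ.isRet = true) :
    φ.isCallRet = true := by
  simp [Act.isCallRet, h]

/-- The removed position `i` cannot be the required `r`: standing before `b` in the list and in the
same thread, it also precedes `b` in the trace. -/
theorem ReorderInv.closed_tail {ptr i : ℕ} {h : List ℕ} (hI : ReorderInv N A ptr (i :: h)) :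
    ∀ b ∈ h, ∀ r, b < r → r < N → (A r).isCallRet = true →
      (A b).thread = (A r).thread → r ∈ h := by
  intro b hb r hbr hr hcr hth
  rcases List.mem_cons.1 (hI.closed b (List.mem_cons_of_mem _ hb) r hbr hr hcr hth) with rfl | h'
  · have := (List.pairwise_cons.1 hI.order).1 b hb (.inl hth.symm)
    omega
  · exact h'

/-- The pointer may pass the call `i` because no return before it is left: a return listed after a
call also follows it in the trace. -/
theorem ReorderInv.call {ptr i : ℕ} {h : List ℕ} (hI : ReorderInv N A ptr (i :: h))
    (hi : (A i).isCall = true) : ReorderInv N A (max ptr (i + 1)) h where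
  le := by
    have := hI.le
    have := hI.lt i (by simp)
    omega
  lt j hj := hI.lt j (List.mem_cons_of_mem _ hj)
  callRet j hj := hI.callRet j (List.mem_cons_of_mem _ hj)
  nodup := (List.nodup_cons.1 hI.nodup).2
  calls j hj hjN hc := by
    rcases List.mem_cons.1 (hI.calls j (by omega) hjN hc) with rfl | h'
    · omega
    · exact h'
  rets j hj hr := by
    have := hI.rets j (List.mem_cons_of_mem _ hj) hr
    have := (List.pairwise_cons.1 hI.order).1 j hj (.inr ⟨hr, hi⟩)
    omega
  closed := hI.closed_tail
  order := (List.pairwise_cons.1 hI.order).2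

theorem ReorderInv.ret {ptr i : ℕ} {h : List ℕ} (hI : ReorderInv N A ptr (i :: h))
    (hi : ¬ (A i).isCall = true) : ReorderInv N A ptr h where
  le := hI.le
  lt j hj := hI.lt j (List.mem_cons_of_mem _ hj)
  callRet j hj := hI.callRet j (List.mem_cons_of_mem _ hj)
  nodup := (List.nodup_cons.1 hI.nodup).2
  calls j hj hjN hc := by
    rcases List.mem_cons.1 (hI.calls j hj hjN hc) with rfl | h'
    · exact absurd hc hi
    · exact h'
  rets j hj hr := hI.rets j (List.mem_cons_of_mem _ hj) hr
  closed := hI.closed_tail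
  order := (List.pairwise_cons.1 hI.order).2

/-- The calls passed when `ptr` is advanced have not been performed, and the returns have. -/
theorem ReorderInv.between {ptr i : ℕ} {h : List ℕ} (hI : ReorderInv N A ptr (i :: h))
    (hi : (A i).isCall = true) {j : ℕ} (h₁ : ptr ≤ j) (h₂ : j < max ptr (i + 1)) :
    j < N ∧ ((A j).isCall = true → j ∈ i :: h) ∧ ((A j).isRet = true → j ∉ i :: h) := by
  have hle := (hI.call hi).le
  refine ⟨by omega, hI.calls j h₁ (by omega), fun hr hj => ?_⟩
  rcases List.mem_cons.1 hj with rfl | hj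
  · exact Act.not_isCall_of_isRet hr hi
  · have := (hI.call hi).rets j hj hr
    omega

theorem filter_callRet_reorder {ptr : ℕ} {h : List ℕ} (hI : ReorderInv N A ptr h) :
    (reorder N A ptr h).filter (fun i => (A i).isCallRet) = h := by
  induction h generalizing ptr with
  | nil => exact filter_callRet_primsBetween _ _
  | cons i h ih =>
    have hi := hI.callRet i (by simp)
    rw [reorder]
    split_ifs with hc
    · rw [List.filter_append, filter_callRet_primsBetween, List.filter_cons_of_pos (by exact hi),
        ih (hI.call hc), List.nil_append]
    · rw [List.filter_cons_of_pos (by exact hi), ih (hI.ret hc)]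

theorem filter_prim_reorder {ptr : ℕ} {h : List ℕ} (hI : ReorderInv N A ptr h) :
    (reorder N A ptr h).filter (fun i => !(A i).isCallRet) = primsBetween A ptr N := by
  induction h generalizing ptr with
  | nil => exact filter_prim_primsBetween _ _
  | cons i h ih =>
    have hi := hI.callRet i (by simp)
    rw [reorder]
    split_ifs with hc
    · rw [List.filter_append, filter_prim_primsBetween, List.filter_cons_of_neg (by simp [hi]),
        ih (hI.call hc), primsBetween_append (le_max_left _ _) (hI.call hc).le]
    · rw [List.filter_cons_of_neg (by simp [hi]), ih (hI.ret hc)]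

theorem mem_reorder {ptr : ℕ} {h : List ℕ} (hI : ReorderInv N A ptr h) {j : ℕ}
    (hj : j ∈ reorder N A ptr h) :
    j ∈ h ∨ (ptr ≤ j ∧ j < N ∧ (A j).isCallRet = false) := by
  by_cases hc : (A j).isCallRet = true
  · left
    rw [← filter_callRet_reorder hI]
    exact List.mem_filter.2 ⟨hj, hc⟩
  · right
    have : j ∈ primsBetween A ptr N := by
      rw [← filter_prim_reorder hI]
      exact List.mem_filter.2 ⟨hj, by simpa using hc⟩
    rw [mem_primsBetween] at this
    exact ⟨this.1.1, this.1.2, this.2⟩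

/-- The reordering preserves the order of actions in each thread. -/
theorem reorder_pairwise
    (hcp : ∀ b p, b < p → p < N → (A b).isCall = true → (A p).isCallRet = false →
      (A b).thread = (A p).thread →
      ∃ r, b < r ∧ r < p ∧ (A r).isRet = true ∧ (A r).thread = (A p).thread)
    (hpr : ∀ b i, b < i → i < N → (A b).isCallRet = false → (A i).isRet = true →
      (A b).thread = (A i).thread →
      ∃ c, b < c ∧ c < i ∧ (A c).isCall = true ∧ (A c).thread = (A i).thread)
    {ptr : ℕ} {h : List ℕ} (hI : ReorderInv N A ptr h) :
    (reorder N A ptr h).Pairwise fun a b => (A a).thread = (A b).thread → a < b := by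
  have hsorted : ∀ a b, (primsBetween A a b).Pairwise
      fun a b => (A a).thread = (A b).thread → a < b :=
    fun a b => (primsBetween_pairwise a b).imp (S := fun a b => (A a).thread = (A b).thread → a < b)
      fun h _ => h
  induction h generalizing ptr with
  | nil => exact hsorted _ _
  | cons i h ih =>
    have hi := hI.callRet i (by simp)
    have hord := (List.pairwise_cons.1 hI.order).1
    rw [reorder]
    split_ifs with hc
    · have hI' := hI.call hc
      refine List.pairwise_append.2 ⟨hsorted _ _, List.pairwise_cons.2 ⟨fun b hb hth => ?_,
        ih hI'⟩, fun p hp b hb hth => ?_⟩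
      · rcases mem_reorder hI' hb with hb | ⟨hb, -, -⟩
        · exact hord b hb (.inl hth)
        · omega
      · obtain ⟨⟨hp₁, hp₂⟩, hp₃⟩ := mem_primsBetween.1 hp
        have hpi : p ≠ i := by
          rintro rfl
          simp [hi] at hp₃
        rcases List.mem_cons.1 hb with rfl | hb
        · omega
        rcases mem_reorder hI' hb with hb | ⟨hb, -, -⟩
        · have hbc := hI'.callRet b hb
          have hpb : p ≠ b := by
            rintro rfl
            simp [hbc] at hp₃
          by_contra hlt
          -- Suppose `b < p` is still to come. If `b` is a call, a return of its thread lies between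
          -- `b` and `p` and is also still to come; otherwise `b` is itself such a return. Either
          -- way a return before the call `i` would be listed after it.
          by_cases hbcall : (A b).isCall = true
          · obtain ⟨r, hr₁, hr₂, hr₃, hr₄⟩ := hcp b p (by omega)
              (by have := hI'.le; omega) hbcall hp₃ hth.symm
            have hrh : r ∈ h := hI'.closed b hb r hr₁ (by have := hI'.le; omega)
              (Act.isCallRet_of_isRet hr₃) (by rw [hr₄, hth])
            have := hord r hrh (.inr ⟨hr₃, hc⟩)
            omega
          · have := hord b hb (.inr ⟨Act.isRet_of_callRet hbc hbcall, hc⟩)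
            omega
        · omega
    · have hI' := hI.ret hc
      refine List.pairwise_cons.2 ⟨fun b hb hth => ?_, ih hI'⟩
      rcases mem_reorder hI' hb with hb | ⟨hb₁, hb₂, hb₃⟩
      · exact hord b hb (.inl hth)
      · have hbi : b ≠ i := by
          rintro rfl
          simp [hi] at hb₃
        by_contra hlt
        -- If `b < i` were not yet performed, a call `c` of the same thread would lie between them.
        -- Being beyond the pointer it is still to come, so it is listed after the return `i`,
        -- against the thread order.
        obtain ⟨c, hc₁, hc₂, hc₃, hc₄⟩ := hpr b i (by omega) (hI.lt i (by simp)) hb₃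
          (Act.isRet_of_callRet hi hc) hth.symm
        rcases List.mem_cons.1 (hI.calls c (by omega)
          (by have := hI.lt i (by simp); omega) hc₃) with rfl | hch
        · omega
        · have := hord c hch (.inl hc₄.symm)
          omega

theorem range_perm_reorder {h : List ℕ} (hI : ReorderInv N A 0 h)
    (hh : h.Perm ((List.range N).filter fun i => (A i).isCallRet)) :
    (reorder N A 0 h).Perm (List.range N) := by
  have h₁ := List.filter_append_perm (fun i => (A i).isCallRet) (reorder N A 0 h)
  have h₂ := List.filter_append_perm (fun i => (A i).isCallRet) (List.range N)
  rw [filter_callRet_reorder hI, filter_prim_reorder hI] at h₁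
  rw [List.range_eq_range'] at h₂ hh ⊢
  exact h₁.symm.trans ((hh.append_right _).trans h₂)

/-- Both lists are strictly increasing and have the same elements. -/
theorem filter_thread_reorder {h : List ℕ} (hI : ReorderInv N A 0 h)
    (hh : h.Perm ((List.range N).filter fun i => (A i).isCallRet))
    (hp : (reorder N A 0 h).Pairwise fun a b => (A a).thread = (A b).thread → a < b)
    (t : ThreadID) :
    (reorder N A 0 h).filter (fun i => (A i).thread = t) =
      (List.range N).filter (fun i => (A i).thread = t) := by
  refine List.Perm.eq_of_pairwise (le := (· < ·)) (fun a b _ _ h₁ h₂ => by omega) ?_ ?_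
    ((range_perm_reorder hI hh).filter _)
  · rw [List.pairwise_filter]
    refine hp.imp fun h ha hb => h ?_
    rw [decide_eq_true_eq] at ha hb
    rw [ha, hb]
  · exact List.pairwise_lt_range.filter _

theorem inMethod_map_range_iff {t : ThreadID} {i : ℕ} :
    InMethod t ((List.range i).map A) ↔ ∃ c < i, (A c).isCall = true ∧ (A c).thread = t ∧
      ∀ r, c < r → r < i → ¬ ((A r).isRet = true ∧ (A r).thread = t) := by
  induction i with
  | zero => simp [not_inMethod_nil]
  | succ i ih =>
    rw [List.range_succ, List.map_append, List.map_singleton, inMethod_snoc_iff, ih]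
    constructor
    · rintro (⟨h₁, h₂⟩ | ⟨⟨c, hc, h₁, h₂, h₃⟩, h₄⟩)
      · exact ⟨i, by omega, h₁, h₂, fun r _ _ => by omega⟩
      · refine ⟨c, by omega, h₁, h₂, fun r hr hri => ?_⟩
        rcases Nat.lt_succ_iff_lt_or_eq.1 hri with hri | rfl
        · exact h₃ r hr hri
        · exact h₄
    · rintro ⟨c, hc, h₁, h₂, h₃⟩
      rcases Nat.lt_succ_iff_lt_or_eq.1 hc with hc | rfl
      · exact .inr ⟨⟨c, hc, h₁, h₂, fun r hr hri => h₃ r hr (by omega)⟩, h₃ i hc (by omega)⟩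
      · exact .inl ⟨h₁, h₂⟩

theorem inMethod_of_position {C : Client Method PComm}
    (h : (List.range N).map A ∈ clientTraces C) {i : ℕ} (hi : i < N) :
    ((A i).isCallRet = false → ¬ InMethod (A i).thread ((List.range i).map A)) ∧
      ((A i).isRet = true → InMethod (A i).thread ((List.range i).map A)) := by
  obtain ⟨k, rfl⟩ := Nat.exists_eq_add_of_lt hi
  rw [List.range_eq_range', add_assoc, ← List.range'_append_1, List.map_append,
    List.range'_succ, List.map_cons, ← List.range_eq_range', zero_add] at h
  exact inMethod_of_mem_clientTraces h

/-- Between a call and a later primitive action by the same thread there is a return. -/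
theorem exists_ret_between {C : Client Method PComm}
    (h : (List.range N).map A ∈ clientTraces C) (b p : ℕ) (hbp : b < p) (hp : p < N)
    (hb : (A b).isCall = true) (hpr : (A p).isCallRet = false)
    (hth : (A b).thread = (A p).thread) :
    ∃ r, b < r ∧ r < p ∧ (A r).isRet = true ∧ (A r).thread = (A p).thread := by
  by_contra hcon
  push Not at hcon
  have := (inMethod_of_position h hp).1 hpr
  rw [inMethod_map_range_iff] at this
  exact this ⟨b, hbp, hb, hth, fun r h₁ h₂ h₃ => hcon r h₁ h₂ h₃.1 h₃.2⟩

/-- Between a primitive action and a later return by the same thread there is a call. -/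
theorem exists_call_between {C : Client Method PComm}
    (h : (List.range N).map A ∈ clientTraces C) (b i : ℕ) (hbi : b < i) (hi : i < N)
    (hb : (A b).isCallRet = false) (hr : (A i).isRet = true)
    (hth : (A b).thread = (A i).thread) :
    ∃ c, b < c ∧ c < i ∧ (A c).isCall = true ∧ (A c).thread = (A i).thread := by
  obtain ⟨c, hc, h₁, h₂, h₃⟩ := inMethod_map_range_iff.1 ((inMethod_of_position h hi).2 hr)
  rcases lt_trichotomy b c with hbc | rfl | hcb
  · exact ⟨c, hbc, hc, h₁, h₂⟩
  · rw [Act.isCallRet_of_isCall h₁] at hb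
    exact absurd hb (by simp)
  -- Had the call `c` come before `b`, a return between them would have closed it.
  · obtain ⟨r, hr₁, hr₂, hr₃, hr₄⟩ := exists_ret_between h c b hcb (by omega) h₁ hb
      (h₂.trans hth.symm)
    exact absurd ⟨hr₃, hr₄.trans hth⟩ (h₃ r hr₁ (by omega))

end Reordering

/-! ### Running the reordered client trace -/

section Rearrangement

open PState

variable {St Method PComm : Type*} [SepAlgebra St]

/-- The state transferred by an interface action. -/
def transferred : Act St Method PComm → PState St
  | Act.call _ _ (some σ) => of σ
  | Act.ret _ _ (some σ) => of σ
  | _ => 1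

/-- The state transferred by the action at position `j` is owned by the client in the reordered
run, in addition to its state in the original run: the action is a call before `ptr` that is still
to be performed or a return from `ptr` on that has been performed. -/
def IsPending (A : ℕ → Act St Method PComm) (ptr : ℕ) (h : List ℕ) (j : ℕ) : Prop :=
  ((A j).isCall = true ∧ j < ptr ∧ j ∈ h) ∨ ((A j).isRet = true ∧ ptr ≤ j ∧ j ∉ h)

open Classical in
/-- The product of the pending states. -/
noncomputable def pending (N : ℕ) (A : ℕ → Act St Method PComm) (ptr : ℕ) (h : List ℕ) :
    PState St :=
  ∏ j ∈ (Finset.range N).filter (IsPending A ptr h), transferred (A j)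

open Classical in
-- Advancing the pointer by one, or performing one call or return, changes the pending status of at
-- most one position, so at most one factor enters or leaves the product.
theorem prod_filter_eq_mul {M : Type*} [CommMonoid M] {s : Finset ℕ} {P Q : ℕ → Prop}
    (F : ℕ → M) {k : ℕ} (hk : k ∈ s) (hP : ¬ P k) (hQ : Q k) (hPQ : ∀ j, j ≠ k → (Q j ↔ P j)) :
    ∏ j ∈ s.filter Q, F j = F k * ∏ j ∈ s.filter P, F j := by
  have : s.filter Q = insert k (s.filter P) := by
    ext j
    simp only [Finset.mem_filter, Finset.mem_insert]
    by_cases hj : j = k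
    · subst hj
      simp [hk, hQ]
    · simp [hj, hPQ j hj]
  rw [this, Finset.prod_insert (by simp [hP])]

variable {N : ℕ} {A U : ℕ → Act St Method PComm}

theorem pending_succ_of_prim {b : ℕ} {h : List ℕ} (hb : (A b).isCallRet = false) :
    pending N A (b + 1) h = pending N A b h := by
  simp only [Act.isCallRet, Bool.or_eq_false_iff] at hb
  unfold pending
  congr 1
  ext j
  simp only [Finset.mem_filter]
  by_cases hj : j = b
  · subst hj
    simp [IsPending, hb.1, hb.2]
  · have h₁ : j < b + 1 ↔ j < b := by omega
    have h₂ : b + 1 ≤ j ↔ b ≤ j := by omega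
    rw [IsPending, IsPending, h₁, h₂]

theorem pending_succ_of_call {b : ℕ} {h : List ℕ} (hN : b < N) (hb : (A b).isCall = true)
    (hbh : b ∈ h) : pending N A (b + 1) h = transferred (A b) * pending N A b h := by
  refine prod_filter_eq_mul (P := IsPending A b h) (Q := IsPending A (b + 1) h)
    (fun j => transferred (A j)) (Finset.mem_range.2 hN) ?_ ?_
    fun j hj => ?_
  · rintro (⟨-, h', -⟩ | ⟨h', -, -⟩)
    · omega
    · exact Act.not_isCall_of_isRet h' hb
  · exact .inl ⟨hb, by omega, hbh⟩
  · have h₁ : j < b + 1 ↔ j < b := by omega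
    have h₂ : b + 1 ≤ j ↔ b ≤ j := by omega
    rw [IsPending, IsPending, h₁, h₂]

theorem pending_of_ret {b : ℕ} {h : List ℕ} (hN : b < N) (hb : (A b).isRet = true)
    (hbh : b ∉ h) : pending N A b h = transferred (A b) * pending N A (b + 1) h := by
  refine prod_filter_eq_mul (P := IsPending A (b + 1) h) (Q := IsPending A b h)
    (fun j => transferred (A j)) (Finset.mem_range.2 hN) ?_ ?_
    fun j hj => ?_
  · rintro (⟨h', -, -⟩ | ⟨-, h', -⟩)
    · exact Act.not_isCall_of_isRet hb h'
    · omega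
  · exact .inr ⟨hb, le_rfl, hbh⟩
  · have h₁ : j < b + 1 ↔ j < b := by omega
    have h₂ : b + 1 ≤ j ↔ b ≤ j := by omega
    rw [IsPending, IsPending, h₁, h₂]

theorem pending_cons_of_call {q i : ℕ} {h : List ℕ} (hN : i < N) (hi : (A i).isCall = true)
    (hiq : i < q) (hih : i ∉ h) :
    pending N A q (i :: h) = transferred (A i) * pending N A q h := by
  refine prod_filter_eq_mul (P := IsPending A q h) (Q := IsPending A q (i :: h))
    (fun j => transferred (A j)) (Finset.mem_range.2 hN) ?_ ?_
    fun j hj => ?_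
  · rintro (⟨-, -, h'⟩ | ⟨h', -, -⟩)
    · exact hih h'
    · exact Act.not_isCall_of_isRet h' hi
  · exact .inl ⟨hi, hiq, by simp⟩
  · simp [IsPending, hj]

theorem pending_of_cons_ret {q i : ℕ} {h : List ℕ} (hN : i < N) (hi : (A i).isRet = true)
    (hiq : q ≤ i) (hih : i ∉ h) :
    pending N A q h = transferred (A i) * pending N A q (i :: h) := by
  refine prod_filter_eq_mul (P := IsPending A q (i :: h)) (Q := IsPending A q h)
    (fun j => transferred (A j)) (Finset.mem_range.2 hN) ?_ ?_
    fun j hj => ?_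
  · rintro (⟨h', -, -⟩ | ⟨-, -, h'⟩)
    · exact Act.not_isCall_of_isRet hi h'
    · simp at h'
  · exact .inr ⟨hi, hiq, hih⟩
  · simp [IsPending, hj]

open Classical in
theorem pending_zero {h : List ℕ} (hh : ∀ j < N, (A j).isRet = true → j ∈ h) :
    pending N A 0 h = 1 := by
  refine Finset.prod_eq_one fun j hj => ?_
  obtain ⟨hj, ⟨-, h', -⟩ | ⟨h₁, -, h₂⟩⟩ := Finset.mem_filter.1 hj
  · omega
  · exact absurd (hh j (Finset.mem_range.1 hj) h₁) h₂

variable {f : PComm → ThreadID → St → Res St} {Γ : MethodSpec Method St} {s : ℕ → St}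

/-- Performing the primitive actions of a run between two positions, with the pending state in
addition. -/
theorem run_primsBetween (hfp : FootprintPreserving f) (hsl : StronglyLocal f)
    (hs : ∀ i < N, (evalClient f Γ (U i) (s i)).Has (s (i + 1), A i)) {h : List ℕ} {a b : ℕ}
    (hab : a ≤ b)
    (hbetw : ∀ j, a ≤ j → j < b →
      j < N ∧ ((A j).isCall = true → j ∈ h) ∧ ((A j).isRet = true → j ∉ h))
    {x : St} (hx : of x = of (s a) * pending N A a h) :
    ∃ x', Run (evalClient f Γ) x ((primsBetween A a b).map U) x' ((primsBetween A a b).map A) ∧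
      of x' = of (s b) * pending N A b h ∧ footprint x' = footprint x := by
  induction b, hab using Nat.le_induction with
  | base =>
    rw [primsBetween_self]
    exact ⟨x, .nil x, hx, rfl⟩
  | succ b hab ih =>
    obtain ⟨x', hr, hx', hfx⟩ := ih fun j h₁ h₂ => hbetw j h₁ (by omega)
    obtain ⟨hN, hcall, hret⟩ := hbetw b hab (by omega)
    have hev := hs b hN
    cases hU : U b with
    | prim t c =>
      rw [hU] at hev
      obtain ⟨hf, hA⟩ := evalPrim_has_iff.1 hev
      have hcr : (A b).isCallRet = false := by rw [hA]; rfl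
      obtain ⟨y, hy⟩ := IsDefined.of_mul_right ⟨x', hx'.symm⟩
      have hd : (of (s b) * pending N A b h).IsDefined := ⟨x', hx'.symm⟩
      -- The action preserves the footprint of `s b`, so its outcome still combines with the pending
      -- states; these serve as the frame.
      obtain ⟨x'', hx''⟩ := hd.congr_footprint (hfp c t _ _ hf).symm
      have hnf : f c t (s b) ≠ Res.fault := fun h₀ => by rw [h₀] at hf; exact hf
      have hstep : (f c t x').Has x'' :=
        (hsl.has_iff (σ₂ := y) (by rw [hx', hy]) hnf).2 ⟨_, hf, by rw [← hx'', hy]⟩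
      refine ⟨x'', ?_, by rw [← hx'', pending_succ_of_prim hcr],
        (hfp c t _ _ hstep).trans hfx⟩
      rw [primsBetween_succ_of_prim hab hcr, List.map_append, List.map_append]
      refine hr.append (.single ?_)
      rw [hU]
      exact evalPrim_has_iff.2 ⟨hstep, hA⟩
    | call t m o =>
      rw [hU] at hev
      obtain ⟨T, σ₁, -, -, hσ, hA⟩ := evalClient_call_has_iff.1 hev
      have hc : (A b).isCall = true := by rw [hA]; rfl
      refine ⟨x', ?_, ?_, hfx⟩
      · rwa [primsBetween_succ_of_callRet hab (Act.isCallRet_of_isCall hc)]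
      -- The original run gives up `σ₁` here while the reordered one keeps it as pending: the total
      -- does not change.
      · rw [hx', pending_succ_of_call hN hc (hcall hc), hσ, hA, mul_comm (of σ₁), mul_assoc]
        rfl
    | ret t m o =>
      rw [hU] at hev
      obtain ⟨T, σ₁, -, -, hσ, hA⟩ := evalClient_ret_has_iff.1 hev
      have hc : (A b).isRet = true := by rw [hA]; rfl
      refine ⟨x', ?_, ?_, hfx⟩
      · rwa [primsBetween_succ_of_callRet hab (Act.isCallRet_of_isRet hc)]
      -- The piece received early stops being pending because the original run has now received it
      -- too.
      · rw [hx', pending_of_ret hN hc (hret hc), hσ, hA, mul_assoc]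
        rfl

/-- A client gives up a state to a library: it stays compatible with the library. -/
theorem compat_of_fpAdd {x x' y σ : St} {l' : Set St} (hxy : Compat x y)
    (hx : of x = of σ * of x') (h : FpAdd (footprint y) (footprint σ) l') :
    ∃ y', footprint y' = l' ∧ Compat x' y' := by
  obtain ⟨σ₁, σ₂, y', h₁, h₂, h₃, rfl⟩ := h
  refine ⟨y', rfl, ?_⟩
  rw [compat_iff, hx] at hxy
  rw [compat_iff, ← op_eq_some_iff.1 h₃]
  -- Exchange `σ` for `σ₂`, then `y` for `σ₁`: equal footprints, and `σ₁ * σ₂` is `y'`.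
  have h := IsDefined.congr_footprint (c := of x' * of y) h₂ (by rwa [← mul_assoc])
  have h' := IsDefined.congr_footprint (c := of x' * of σ₂) h₁ (by
    convert h using 1
    rw [mul_comm (of y), mul_comm (of x'), mul_assoc])
  convert h' using 1
  rw [mul_left_comm]

/-- A client receives a state from a library: this is defined, and it stays compatible with the
library. -/
theorem compat_of_fpSub {x y σ : St} {l' : Set St} (hxy : Compat x y)
    (h : FpSub (footprint y) (footprint σ) l') :
    ∃ x' y', of x' = of x * of σ ∧ footprint y' = l' ∧ Compat x' y' := by
  obtain ⟨σ₁, σ₂, y', h₁, h₂, h₃, rfl⟩ := h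
  rw [compat_iff, mul_comm] at hxy
  -- Exchange `y` for `σ₂`, which is `σ₁ * y'`, then `σ₁` for `σ`.
  have h := hxy.congr_footprint h₂
  rw [← op_eq_some_iff.1 h₃, mul_assoc] at h
  have h' := h.congr_footprint h₁.symm
  have e : of σ * (of y' * of x) = (of x * of σ) * of y' := by
    rw [mul_comm (of y'), ← mul_assoc, mul_comm (of σ)]
  rw [e] at h'
  obtain ⟨x', hx'⟩ := h'.of_mul_left
  exact ⟨x', y', hx'.symm, rfl, by rwa [compat_iff, ← hx']⟩

/-- The reordered trace can be run. -/
theorem run_reorder (hfp : FootprintPreserving f) (hsl : StronglyLocal f)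
    (hs : ∀ i < N, (evalClient f Γ (U i) (s i)).Has (s (i + 1), A i))
    (hUA : ∀ i, (U i).ground = (A i).ground) {ptr : ℕ} {h : List ℕ}
    (hI : ReorderInv N A ptr h) {x y : St} (hxy : Compat x y)
    (hbal : Balanced (h.map A) (footprint y)) (hx : of x = of (s ptr) * pending N A ptr h) :
    ∃ x', Run (evalClient f Γ) x ((reorder N A ptr h).map U) x' ((reorder N A ptr h).map A) := by
  induction h generalizing ptr x y with
  | nil =>
    obtain ⟨x', hr, -⟩ := run_primsBetween hfp hsl hs hI.le
      (fun j h₁ h₂ => ⟨h₂, hI.calls j h₁ h₂, by simp⟩) hx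
    exact ⟨x', hr⟩
  | cons i h ih =>
    -- The state `y` merely represents the footprint reached by the history; it need not occur in
    -- any library run.
    obtain ⟨l, l', hstep, htrack⟩ := hbal
    have hiN := hI.lt i (by simp)
    have hih := (List.nodup_cons.1 hI.nodup).1
    have hev := hs i hiN
    rw [reorder]
    cases hU : U i with
    | prim t c =>
      have := hI.callRet i (by simp)
      rw [← Act.isCallRet_ground, ← hUA, hU] at this
      exact absurd this (by simp [Act.ground, Act.isCallRet, Act.isCall, Act.isRet])
    | call t m o =>
      rw [hU] at hev
      obtain ⟨T, σ₁, hT, h₁, -, hA⟩ := evalClient_call_has_iff.1 hev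
      have hc : (A i).isCall = true := by rw [hA]; rfl
      rw [if_pos hc]
      obtain ⟨x₁, hr₁, hx₁, hfx₁⟩ := run_primsBetween hfp hsl hs
        (b := max ptr (i + 1)) (le_max_left _ _) (fun j => hI.between hc) hx
      -- The bound `i + 1` puts the call `i` itself behind the pointer, so the piece `σ₁` to be
      -- given up is one of the pending ones.
      rw [pending_cons_of_call hiN hc (by omega) hih, mul_left_comm,
        show transferred (A i) = of σ₁ by rw [hA]; rfl] at hx₁
      obtain ⟨x₂, hx₂⟩ := IsDefined.of_mul_right ⟨x₁, hx₁.symm⟩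
      rw [hA] at hstep
      obtain ⟨y', rfl, hxy'⟩ := compat_of_fpAdd ((compat_of_footprint_eq hfx₁ y).2 hxy)
        (hx₁.trans (by rw [hx₂])) hstep
      obtain ⟨x', hr'⟩ := ih (hI.call hc) hxy' ⟨l, htrack⟩ hx₂.symm
      rw [List.map_append, List.map_append, List.map_cons, List.map_cons]
      refine ⟨x', hr₁.append (.cons ?_ hr')⟩
      rw [hU, hA]
      exact evalClient_call_has_iff.2 ⟨T, σ₁, hT, h₁, hx₁.trans (by rw [hx₂]), rfl⟩
    | ret t m o =>
      rw [hU] at hev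
      obtain ⟨T, σ₁, hT, h₁, -, hA⟩ := evalClient_ret_has_iff.1 hev
      have hr : (A i).isRet = true := by rw [hA]; rfl
      have hc := Act.not_isCall_of_isRet hr
      rw [if_neg hc]
      rw [hA] at hstep
      -- Balancedness alone makes the returned piece compatible with all that the client owns,
      -- pending pieces included.
      obtain ⟨x₂, y', hx₂, rfl, hxy'⟩ := compat_of_fpSub hxy hstep
      obtain ⟨x', hr'⟩ := ih (hI.ret hc) hxy' ⟨l, htrack⟩ (by
        rw [hx₂, hx, pending_of_cons_ret hiN hr (hI.rets i (by simp) hr) hih, hA, mul_assoc,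
          mul_comm (pending N A ptr (i :: h))]
        rfl)
      rw [List.map_cons, List.map_cons]
      refine ⟨x', .cons ?_ hr'⟩
      rw [hU, hA]
      exact evalClient_ret_has_iff.2 ⟨T, σ₁, hT, h₁, hx₂, rfl⟩

omit [SepAlgebra St] in
/-- The positions of the actions of a history in the order of a linearization. -/
theorem HistLin.exists_positions {p : List ℕ} (hp : p.Pairwise (· < ·))
    {H : Trace St Method PComm} (hlin : HistLin (p.map A) H) :
    ∃ h : List ℕ, h.map A = H ∧ h.Perm p ∧
      h.Pairwise fun a b => (A a).thread = (A b).thread ∨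
        ((A b).isRet = true ∧ (A a).isCall = true) → a < b := by
  obtain ⟨ρ, hρ⟩ := hlin
  have hlen : ∀ k, (ρ.symm k : ℕ) < p.length := fun k => by
    simpa using (ρ.symm k).2
  have hget : ∀ k, A p[(ρ.symm k : ℕ)] = (p.map A).get (ρ.symm k) := fun k => by simp
  have hinj : Function.Injective fun k => p[(ρ.symm k : ℕ)]'(hlen k) := fun k k' hk => by
    have := (List.Nodup.getElem_inj_iff (hp.imp fun h => h.ne)).1 hk
    exact ρ.symm.injective (Fin.ext this)
  refine ⟨List.ofFn fun k => p[(ρ.symm k : ℕ)]'(hlen k), ?_, ?_, ?_⟩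
  · rw [List.map_ofFn]
    conv_rhs => rw [← List.ofFn_get H]
    congr 1
    funext k
    have := (hρ (ρ.symm k) (ρ.symm k)).1
    rw [ρ.apply_symm_apply, ← hget] at this
    exact this
  · rw [List.perm_ext_iff_of_nodup (List.nodup_ofFn.2 hinj) (hp.imp fun h => h.ne)]
    intro a
    rw [List.mem_ofFn]
    constructor
    · rintro ⟨k, rfl⟩
      exact List.getElem_mem _
    · intro ha
      obtain ⟨n, hn, rfl⟩ := List.getElem_of_mem ha
      exact ⟨ρ ⟨n, by simpa using hn⟩, by simp⟩
  · rw [List.pairwise_ofFn]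
    intro k k' hk hcond
    -- If the position listed later lay earlier in the trace, the linearization would keep it
    -- earlier, contrary to `k < k'`.
    by_contra hlt
    have hne : (ρ.symm k' : ℕ) ≠ ρ.symm k := fun h =>
      hk.ne' (ρ.symm.injective (Fin.ext h))
    have hlt' : (ρ.symm k' : ℕ) < ρ.symm k := by
      by_contra hge
      exact hlt (List.pairwise_iff_getElem.1 hp _ _ (hlen k) (hlen k') (by omega))
    have := (hρ (ρ.symm k') (ρ.symm k)).2 ⟨hlt', by
      rw [← hget, ← hget]
      exact hcond.imp Eq.symm id⟩
    rw [ρ.apply_symm_apply, ρ.apply_symm_apply] at this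
    exact absurd hk this.not_gt

omit [SepAlgebra St] in
theorem projThread_map (t : ThreadID) (l : List ℕ) :
    projThread t (l.map A) = (l.filter fun i => (A i).thread = t).map A := List.filter_map ..

/-- A run of a client can be rearranged to have a given history linearizing its history, if the
former is balanced from a footprint compatible with the initial state. -/
theorem Run.rearrange (hfp : FootprintPreserving f) (hsl : StronglyLocal f)
    {C : Client Method PComm} {σ σ' y : St} {u κ H : Trace St Method PComm}
    (hu : u ∈ clientTraces C) (hr : Run (evalClient f Γ) σ u σ' κ) (hg : ground κ = ground u)
    (hlin : HistLin (history κ) H) (hbal : Balanced H (footprint y)) (hσy : Compat σ y) :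
    ∃ v ∈ clientTraces C, ∃ σ₁ κ₁, Run (evalClient f Γ) σ v σ₁ κ₁ ∧ history κ₁ = H ∧
      (∀ t, projThread t κ₁ = projThread t κ) ∧
      κ₁.filter (fun φ => !φ.isCallRet) = κ.filter (fun φ => !φ.isCallRet) := by
  obtain ⟨hlen, s, rfl, hs⟩ := hr.exists_states
  -- Actions are to be indexed by all of `ℕ`; a nonempty `κ` supplies the default value `d`.
  rcases κ.eq_nil_or_concat with rfl | ⟨_, d, -⟩
  · obtain rfl : u = [] := List.length_eq_zero_iff.1 hlen
    obtain ⟨ρ, -⟩ := hlin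
    obtain rfl : H = [] := by
      have := Fintype.card_congr ρ
      rw [Fintype.card_fin, Fintype.card_fin] at this
      exact List.length_eq_zero_iff.1 this.symm
    exact ⟨[], hu, s 0, [], .nil _, rfl, fun _ => rfl, rfl⟩
  set N := κ.length with hN
  let A : ℕ → Act St Method PComm := fun i => κ.getD i d
  let U : ℕ → Act St Method PComm := fun i => u.getD i d
  have hκ : κ = (List.range N).map A := by
    refine List.ext_getElem (by simp [hN]) fun i h₁ h₂ => ?_
    simp [A, h₁]
  have hu' : u = (List.range N).map U := by
    refine List.ext_getElem (by simp [hN, hlen]) fun i h₁ h₂ => ?_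
    simp [U, h₁]
  -- Beyond the ends both sides are the erasure of `d`, so no bound on `i` is needed.
  have hUA : ∀ i, (U i).ground = (A i).ground := fun i => by
    have h₁ : (ground κ)[i]?.getD d.ground = (ground u)[i]?.getD d.ground := by rw [hg]
    simp only [ground, List.getElem?_map] at h₁
    simp only [A, U, List.getD_eq_getElem?_getD]
    revert h₁
    cases u[i]? <;> cases κ[i]? <;> simp [eq_comm]
  have hth : ∀ i, (U i).thread = (A i).thread := fun i => by
    rw [← Act.thread_ground, hUA, Act.thread_ground]
  have hcall : ∀ i, (U i).isCall = (A i).isCall := fun i => by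
    rw [← Act.isCall_ground, hUA, Act.isCall_ground]
  have hret : ∀ i, (U i).isRet = (A i).isRet := fun i => by
    rw [← Act.isRet_ground, hUA, Act.isRet_ground]
  have hcr : ∀ i, (U i).isCallRet = (A i).isCallRet := fun i => by
    rw [← Act.isCallRet_ground, hUA, Act.isCallRet_ground]
  have hs' : ∀ i < N, (evalClient f Γ (U i) (s i)).Has (s (i + 1), A i) := fun i hi => by
    refine hs i _ _ ?_ ?_
    · have : i < u.length := by omega
      simp [U, this]
    · have : i < κ.length := hi
      simp [A, this]
  have hhist : history κ = ((List.range N).filter fun i => (A i).isCallRet).map A := by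
    conv_lhs => rw [hκ]
    exact List.filter_map ..
  rw [hhist] at hlin
  obtain ⟨h, rfl, hperm, hord⟩ := hlin.exists_positions (List.pairwise_lt_range.filter _)
  have hmem : ∀ i, i ∈ h ↔ i < N ∧ (A i).isCallRet = true := fun i => by
    rw [hperm.mem_iff, List.mem_filter, List.mem_range]
  have hI : ReorderInv N A 0 h :=
    { le := Nat.zero_le _
      lt := fun i hi => ((hmem i).1 hi).1
      callRet := fun i hi => ((hmem i).1 hi).2
      nodup := hperm.nodup_iff.2 (List.nodup_range.filter _)
      calls := fun j _ hj hc => (hmem j).2 ⟨hj, Act.isCallRet_of_isCall hc⟩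
      rets := fun _ _ _ => Nat.zero_le _
      closed := fun _ _ r _ hr hc _ => (hmem r).2 ⟨hr, hc⟩
      order := hord }
  have huT := hu' ▸ hu
  have hcp := exists_ret_between huT
  have hpr := exists_call_between huT
  simp only [hth, hcall, hret, hcr] at hcp hpr
  have hpair := reorder_pairwise hcp hpr hI
  have hfilter := filter_thread_reorder hI hperm hpair
  obtain ⟨x', hrun⟩ := run_reorder hfp hsl hs' hUA hI hσy hbal (by
    rw [pending_zero fun j hj hr => (hmem j).2 ⟨hj, Act.isCallRet_of_isRet hr⟩, mul_one])
  refine ⟨_, ?_, x', _, hrun, ?_, fun t => ?_, ?_⟩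
  · obtain ⟨w, ⟨hw₁, hw₂⟩, r, rfl⟩ := hu
    -- The same remainder `r` completes the reordered trace, as each thread's projection is
    -- unchanged.
    refine ⟨(reorder N A 0 h).map U ++ r, ⟨fun φ hφ => hw₁ φ ?_, fun i => ?_⟩,
      List.prefix_append ..⟩
    · rw [hu']
      rcases List.mem_append.1 hφ with hφ | hφ
      · exact List.mem_append_left _
          ((((range_perm_reorder hI hperm).map U).mem_iff).1 hφ)
      · exact List.mem_append_right _ hφ
    · have := hw₂ i
      rw [hu', projThread_append, projThread_map] at this
      rw [projThread_append, projThread_map]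
      simp only [hth] at this ⊢
      rwa [hfilter]
  · rw [history, List.filter_map]
    exact congrArg _ (filter_callRet_reorder hI)
  · conv_rhs => rw [hκ]
    rw [projThread_map, projThread_map, hfilter]
  · conv_rhs => rw [hκ]
    rw [List.filter_map, List.filter_map]
    refine congrArg _ ((filter_prim_reorder hI).trans ?_)
    rw [primsBetween, Nat.sub_zero, ← List.range_eq_range']
    rfl

end Rearrangement
end OwnershipLin

open OwnershipLin SepAlgebra PState in
theorem mainTheorem2 {St Method PComm : Type*} [SepAlgebra St]
    (hfc : OwnershipLin.FootprintCancellative St)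
    (f : PComm → OwnershipLin.ThreadID → St → OwnershipLin.Res St)
    (hfp : OwnershipLin.FootprintPreserving f) (hsl : OwnershipLin.StronglyLocal f)
    (Γ : OwnershipLin.MethodSpec Method St)
    (L₁ : OwnershipLin.Library Method PComm) (C : OwnershipLin.Client Method PComm)
    (hL₁ : L₁.SpecifiedBy Γ) (hC : C.SpecifiedBy Γ)
    (I₁ I : Set St)
    (hL₁safe : OwnershipLin.Safe (OwnershipLin.denoteLibrary f L₁ Γ) I₁)
    (hCsafe : OwnershipLin.Safe (OwnershipLin.denoteClient f Γ C) I)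
    (ℋ₂ : Set (Set St × OwnershipLin.Trace St Method PComm))
    (hℋ₂ : OwnershipLin.IsInterfaceSet ℋ₂)
    (hlin : OwnershipLin.InterfLin (OwnershipLin.interf f L₁ Γ I₁) ℋ₂) :
    OwnershipLin.Safe (OwnershipLin.denoteComplete f C L₁) (OwnershipLin.sepSet I I₁) ∧
    ∀ σ τ₁, (σ, τ₁) ∈ OwnershipLin.behaviours (OwnershipLin.denoteComplete f C L₁)
        (OwnershipLin.sepSet I I₁) →
      ∃ σ' κ l,
        (σ', κ) ∈ OwnershipLin.behaviours (OwnershipLin.denoteClient f Γ C) I ∧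
        (l, OwnershipLin.history κ) ∈ ℋ₂ ∧
        OwnershipLin.FpCompat (OwnershipLin.footprint σ') l ∧
        OwnershipLin.ClientEquiv (OwnershipLin.client τ₁) (OwnershipLin.ground κ) := by
  have hcalls : ∀ i, ∀ m ∈ (C.thread i).calls, m ∈ L₁.methods :=
    fun i m hm => (hL₁ m).2 (hC i m hm)
  have hsafe : Safe (denoteComplete f C L₁) (sepSet I I₁) := by
    rintro σ ⟨σc, hσc, σl, hσl, hσ⟩
    exact denote_ne_fault_iff.2 fun τ hτ => (complete_split hsl hcalls
      (op_eq_some_iff.1 hσ).symm (hCsafe σc hσc) (hL₁safe σl hσl) hτ).1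
  refine ⟨hsafe, ?_⟩
  rintro σ τ₁ ⟨hσI, hτ₁⟩
  obtain ⟨τ, hτ, σ', hrun⟩ := (denote_has_iff (hsafe σ hσI)).1 hτ₁
  obtain ⟨σc, hσc, σl, hσl, hσ⟩ := hσI
  obtain ⟨σc', σl', κ, ξ, -, rc, rl, hh, hg⟩ := (complete_split hsl hcalls
    (op_eq_some_iff.1 hσ).symm (hCsafe σc hσc) (hL₁safe σl hσl) hτ).2 _ _ hrun
  obtain ⟨hcτ, hlτ⟩ := client_and_insideMethods_mem_traces (St := St) hcalls hτ
  obtain ⟨l, H, hH, ⟨l', y, σl₂, z, rfl, hσl₂, hyz, -⟩, hHlin⟩ := hlin (footprint σl) (history ξ)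
    ⟨σl, ξ, ⟨hσl, (denote_has_iff (hL₁safe σl hσl)).2 ⟨_, hlτ, σl', rl⟩⟩, rfl⟩
  -- The history starts from the footprint of `y`, where `y * z` is a state with the footprint of
  -- `σl`. Since `σc` is compatible with `σl`, it is compatible with `y * z` and hence with `y`.
  have hcy : Compat σc y := by
    have h₁ : (of σl * of σc).IsDefined := ⟨σ, by rw [mul_comm]; exact op_eq_some_iff.1 hσ⟩
    have h₂ := h₁.congr_footprint hσl₂
    rw [← op_eq_some_iff.1 hyz, mul_right_comm, mul_comm (of y)] at h₂
    exact h₂.of_mul_left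
  rw [← hh] at hHlin
  obtain ⟨v, hv, σ₁, κ₁, hr₁, rfl, hproj, hprim⟩ :=
    rc.rearrange hfp hsl hcτ hg hHlin (hℋ₂ _ _ hH).2.2 hcy
  obtain ⟨w, hw⟩ := hcy
  refine ⟨σc, κ₁, footprint y, ⟨hσc, (denote_has_iff (hCsafe σc hσc)).2 ⟨v, hv, σ₁, hr₁⟩⟩, hH,
    ⟨footprint w, σc, y, w, rfl, rfl, hw, rfl⟩, ?_⟩
  obtain rfl : τ₁ = ground τ := hrun.ground_eq_of_complete
  rw [client_ground, ← hg]
  -- The projections in `ClientEquiv` ignore annotations, so they commute with erasing them.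
  have hcomm : ∀ (q : Act St Method PComm → Bool), (∀ φ, q φ.ground = q φ) →
      ∀ τ : Trace St Method PComm, (ground τ).filter q = ground (τ.filter q) := fun q hq τ => by
    rw [ground, ground, List.filter_map]
    congr 2
    exact funext hq
  refine ⟨fun t => ?_, ?_⟩
  · have hq := hcomm (fun φ => φ.thread = t) fun φ => by simp only [Act.thread_ground]
    exact (hq κ).trans ((congrArg ground (hproj t).symm).trans (hq κ₁).symm)
  · have hq := hcomm (fun φ => !φ.isCallRet) fun φ => by simp only [Act.isCallRet_ground]
    rw [hq, hq, hprim]
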